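/- Let $0<\alpha<1$ and let $L=(L(t))_{t\ge 0}$ be an $\alpha$-selfsimilar subordinator, i.e. a Lévy process (stationary independent increments, continuous in probability, $L(0)=0$ and càdlàg paths almost surely) with non-negative increments whose Lévy measure $\lambda$ on $(0,\infty)$, determined by $\int_0^\infty\min\{x,1\}\,\lambda(dx)<\infty$ and $$\mathbf E[e^{-\omega L(t)}]=\exp\Big(-t\int_0^\infty(1-e^{-\omega x})\,\lambda(dx)\Big)\qquad(\omega,t\ge 0),$$ has tail $\Lambda(x)=\lambda((x,\infty))=x^{-\alpha}$ for all $x>0$. For $t>0$ and $n\ge 1$ let $X_n(t)$ denote the size of the $n$-th largest flight (jump) $L(s)-L(s-)$, $s\in[0,t]$, of $L$ during $[0,t]$. Then for all $t>0$, $p>0$ and all integers $n,m\ge 1$, the random variable $(X_{n+m}(t)/X_n(t))^p$ is integrable and $$\mathbf E\left[\left(\frac{X_{n+m}(t)}{X_n(t)}\right)^p\right]=\prod_{k=n}^{n+m-1}\frac{k}{k+p/\alpha}.$$ In particular, $$\mathbf E\left[\left(\frac{X_{n+1}(t)}{X_n(t)}\right)^p\right]=\frac{n}{n+p/\alpha},\qquad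 \mathbf E\left[\left(\frac{X_{1+m}(t)}{X_1(t)}\right)^p\right]=\prod_{k=1}^{m}\frac{k}{k+p/\alpha}.$$ -/

import Mathlib

open MeasureTheory ProbabilityTheory Filter Topology
open scoped NNReal ENNReal

/-- A path `f : [0,∞) → ℝ` is càdlàg: it is right continuous and has left limits. -/
def IsCadlagPath (f : ℝ≥0 → ℝ) : Prop :=
  ∀ t, ContinuousWithinAt f (Set.Ici t) t ∧ ∃ l, Tendsto f (𝓝[<] t) (𝓝 l)

/-- A Lévy process started at `0`: it has independent and stationary increments, is continuous
in probability and (so that its jumps make sense) almost surely has càdlàg paths. -/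
structure IsLevyProcess {Ω : Type*} [MeasurableSpace Ω] (L : ℝ≥0 → Ω → ℝ) (μ : Measure Ω) :
    Prop where
  measurable : ∀ t, Measurable (L t)
  zero : ∀ᵐ ω ∂μ, L 0 ω = 0
  indep : HasIndepIncrements L μ
  stationary : ∀ s h : ℝ≥0,
    IdentDistrib (fun ω => L (s + h) ω - L s ω) (fun ω => L h ω - L 0 ω) μ μ
  continuousInProbability : ∀ t, TendstoInMeasure μ L (𝓝 t) (L t)
  cadlag : ∀ᵐ ω ∂μ, IsCadlagPath (fun t => L t ω)

/-- A one-sided Lévy process (subordinator): a Lévy process with non-negative increments. -/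
structure IsSubordinator {Ω : Type*} [MeasurableSpace Ω] (L : ℝ≥0 → Ω → ℝ) (μ : Measure Ω) :
    Prop extends IsLevyProcess L μ where
  nonneg_increments : ∀ s t : ℝ≥0, s ≤ t → ∀ᵐ ω ∂μ, 0 ≤ L t ω - L s ω

/-- `ν` is the Lévy measure of the (driftless) subordinator `L`: a measure on `(0,∞)` with
`∫ min(x,1) ν(dx) < ∞` such that `E[exp(-θ L(t))] = exp(-t ∫ (1 - exp(-θ x)) ν(dx))`. -/
structure HasLevyMeasure {Ω : Type*} [MeasurableSpace Ω] (L : ℝ≥0 → Ω → ℝ) (μ : Measure Ω)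
    (ν : Measure ℝ) : Prop where
  support : ν (Set.Iic 0) = 0
  integrable_min : ∫⁻ x, ENNReal.ofReal (min x 1) ∂ν < ∞
  laplace : ∀ (θ : ℝ), 0 ≤ θ → ∀ t : ℝ≥0,
    ∫ ω, Real.exp (-θ * L t ω) ∂μ = Real.exp (-(∫ x, (1 - Real.exp (-θ * x)) ∂ν) * t)

/-- The flight tail `Λ(x) = ν((x,∞))` of a Lévy measure `ν`. -/
noncomputable def flightTail (ν : Measure ℝ) (x : ℝ) : ℝ≥0∞ := ν (Set.Ioi x)

/-- `L` is an `α`-selfsimilar subordinator: its flight tail is `Λ(x) = 1 / x ^ α`, `x > 0`. -/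
def IsSelfsimilarSubordinator {Ω : Type*} [MeasurableSpace Ω] (α : ℝ) (L : ℝ≥0 → Ω → ℝ)
    (μ : Measure Ω) : Prop :=
  IsSubordinator L μ ∧ ∃ ν : Measure ℝ, HasLevyMeasure L μ ν ∧
    ∀ x : ℝ, 0 < x → flightTail ν x = ENNReal.ofReal (1 / x ^ α)

/-- The flight (jump) `f(s) - f(s-)` of the path `f` at time `s`; it is `0` at `s = 0`. -/
noncomputable def flight (f : ℝ≥0 → ℝ) (s : ℝ≥0) : ℝ := f s - Function.leftLim f s

/-- The size `X_n(t)` of the `n`-th largest flight of the path `f` during `[0,t]` (`n ≥ 1`,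
flights counted with multiplicity): the largest `x > 0` such that at least `n` flights during
`[0,t]` have size at least `x`. It is `0` if there are fewer than `n` positive flights. -/
noncomputable def nthLargestFlight (f : ℝ≥0 → ℝ) (n : ℕ) (t : ℝ≥0) : ℝ :=
  sSup {x : ℝ | 0 < x ∧ (n : ℕ∞) ≤ {s : ℝ≥0 | s ∈ Set.Icc 0 t ∧ x ≤ flight f s}.encard}

/-- The order sequence `X_n(t)` of the process `L`: its `n`-th largest flight during `[0,t]`. -/
noncomputable def orderFlight {Ω : Type*} (L : ℝ≥0 → Ω → ℝ) (n : ℕ) (t : ℝ≥0) (ω : Ω) : ℝ :=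
  nthLargestFlight (fun s => L s ω) n t

/-! ### Flights of a monotone right-continuous path -/

/-! Heuristically, the points t·Λ(X_n(t)) are the arrival times of a unit rate Poisson process, so
(X_{n+m}/X_n)^α is a ratio of the n-th to the (n+m)-th arrival time, which is Beta(n, m)
distributed. Its moment of order q = p/α is B(n+q, m)/B(n, m), and the Gamma recursion turns this
into the product.

The proof replaces the Poisson process by a discretisation that is already exact at every level. Cut
[0,t] into K equal intervals. The increments of L are i.i.d. with the law of L(t/K), which has no
atoms, so its tail function maps them to i.i.d. uniform variables and reverses their order. The
ratio of two order statistics of uniform variables has the Beta moments above for every K large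
enough for both ranks to exist (`lintegral_rankRatio`, `map_uniformIncrement`).

As K → ∞, the n-th largest increment tends to X_n(t) (`tendsto_nthLargestFlight`), and K/t times the
tail of L(t/K) tends to x^(-α) (`tendsto_law_Ioi`). The factor K/t cancels in ratios, so the ratio
of uniforms tends almost surely to (X_{n+m}/X_n)^α. All ratios are at most 1, so dominated
convergence transfers the constant expectation to the limit.

Three facts support this: convergence of tails follows from the Laplace transforms by Weierstrass
approximation in the variable exp(-x); absence of atoms follows from selfsimilarity through a
maximal atom argument (`law_singleton_eq_zero`); and X_n(t) > 0 almost surely follows from an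
exponential bound on the number of large increments (`ae_orderFlight_pos`). -/

lemma flight_zero (f : ℝ≥0 → ℝ) : flight f 0 = 0 := by
  have h : 𝓝[<] (0 : ℝ≥0) = ⊥ := by
    have : Set.Iio (0 : ℝ≥0) = ∅ := by ext; simp
    rw [this, nhdsWithin_empty]
  rw [flight, leftLim_eq_of_eq_bot f h, sub_self]

lemma flight_le_sub {f : ℝ≥0 → ℝ} (hf : Monotone f) {a s b : ℝ≥0} (ha : a < s) (hb : s ≤ b) :
    flight f s ≤ f b - f a := by
  have h1 := hf.le_leftLim ha
  have h2 := hf hb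
  unfold flight
  linarith

lemma flight_le_of_le {f : ℝ≥0 → ℝ} (hf : Monotone f) {s t : ℝ≥0} (h : s ≤ t) :
    flight f s ≤ f t - f 0 := by
  rcases eq_or_lt_of_le (zero_le (a := s)) with h0 | h0
  · rw [← h0, flight_zero]
    exact sub_nonneg.2 (hf (zero_le))
  · exact flight_le_sub hf h0 h

/-- Close to s, the path stays within η of its left limit on the left and within η of its value on
the right. An interval on one side of s therefore has increment below η, and one straddling s has
increment below the flight plus 2η. -/
lemma exists_nhds_flight_of_le_sub {f : ℝ≥0 → ℝ} (hf : Monotone f)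
    (hc : ∀ s, ContinuousWithinAt f (Set.Ici s) s) {x : ℝ} (hx : 0 < x) (s : ℝ≥0) :
    ∃ U, IsOpen U ∧ s ∈ U ∧ ∀ a ∈ U, ∀ b ∈ U, a ≤ b → x ≤ f b - f a →
      a < s ∧ s ≤ b ∧ x ≤ flight f s := by
  -- If the flight at s is below x, half the gap makes straddling increments smaller than x;
  -- otherwise only one-sided intervals must be excluded and η = x suffices.
  obtain ⟨η, hη0, hηx, hη⟩ : ∃ η > 0, η ≤ x ∧ (flight f s < x → flight f s + 2 * η ≤ x) := by
    by_cases h : flight f s < x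
    · have h0 : 0 ≤ flight f s := sub_nonneg.2 (hf.leftLim_le le_rfl)
      exact ⟨(x - flight f s) / 2, by linarith, by linarith, fun _ => by linarith⟩
    · exact ⟨x, hx, le_rfl, fun h' => absurd h' h⟩
  have h1 : ∀ᶠ y in 𝓝 s, y < s → Function.leftLim f s - η < f y := by
    have := (hf.tendsto_leftLim s).eventually (lt_mem_nhds (sub_lt_self _ hη0))
    exact eventually_nhdsWithin_iff.1 this
  have h2 : ∀ᶠ y in 𝓝 s, s ≤ y → f y < f s + η := by
    have := (hc s).eventually (gt_mem_nhds (lt_add_of_pos_right (f s) hη0))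
    exact eventually_nhdsWithin_iff.1 this
  obtain ⟨U, hU, hUo, hs⟩ := eventually_nhds_iff.1 (h1.and h2)
  refine ⟨U, hUo, hs, fun a ha b hb hab hx' => ?_⟩
  have has : a < s := by
    by_contra h
    push Not at h
    have := (hU b hb).2 (h.trans hab)
    have := hf h
    linarith
  have hsb : s ≤ b := by
    by_contra h
    push Not at h
    have := (hU a ha).1 has
    have := hf.le_leftLim h
    linarith
  refine ⟨has, hsb, ?_⟩
  by_contra h
  push Not at h
  have h3 := hη h
  have h4 := (hU a ha).1 has
  have h5 := (hU b hb).2 hsb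
  unfold flight at h3
  linarith

/-- The neighbourhoods of the previous lemma cover the compact interval [0,t], and their Lebesgue
number gives a uniform δ. -/
lemma exists_flight_of_le_sub {f : ℝ≥0 → ℝ} (hf : Monotone f)
    (hc : ∀ s, ContinuousWithinAt f (Set.Ici s) s) {x : ℝ} (hx : 0 < x) (t : ℝ≥0) :
    ∃ δ > 0, ∀ a b, a ≤ b → b ≤ t → dist b a < δ → x ≤ f b - f a →
      ∃ s, a < s ∧ s ≤ b ∧ x ≤ flight f s := by
  choose U hUo hU hUx using exists_nhds_flight_of_le_sub hf hc hx
  obtain ⟨δ, hδ, h⟩ := lebesgue_number_lemma_of_metric (isCompact_Icc (a := (0 : ℝ≥0)) (b := t))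
    hUo (fun s _ => Set.mem_iUnion.2 ⟨s, hU s⟩)
  refine ⟨δ, hδ, fun a b hab hb hd hx' => ?_⟩
  obtain ⟨s, hs⟩ := h a ⟨zero_le, hab.trans hb⟩
  exact ⟨s, hUx s a (hs (Metric.mem_ball_self hδ)) b (hs hd) hab hx'⟩

/-- The `i`-th point of the partition of `[0,t]` into `K` intervals of equal length. -/
noncomputable def gridPoint (t : ℝ≥0) (K i : ℕ) : ℝ≥0 := t * i / K

/-- The increment of `f` over the `i`-th of `K` intervals of equal length of `[0,t]`. -/
noncomputable def gridIncrement (f : ℝ≥0 → ℝ) (t : ℝ≥0) (K i : ℕ) : ℝ :=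
  f (gridPoint t K (i + 1)) - f (gridPoint t K i)

lemma gridPoint_mono (t : ℝ≥0) (K : ℕ) : Monotone (gridPoint t K) := fun i j h => by
  unfold gridPoint
  gcongr

lemma gridPoint_succ (t : ℝ≥0) (K i : ℕ) : gridPoint t K (i + 1) = gridPoint t K i + t / K := by
  unfold gridPoint
  push_cast
  rw [mul_add, add_div, mul_one]

lemma gridPoint_le {t : ℝ≥0} {K i : ℕ} (h : i ≤ K) : gridPoint t K i ≤ t := by
  rcases Nat.eq_zero_or_pos K with h0 | h0
  · simp [gridPoint, h0]
  · unfold gridPoint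
    rw [div_le_iff₀ (by positivity)]
    gcongr

lemma exists_gridPoint_lt_le {t s : ℝ≥0} (hs : 0 < s) (hst : s ≤ t) {K : ℕ} (hK : 0 < K) :
    ∃ i : Fin K, gridPoint t K i < s ∧ s ≤ gridPoint t K (i + 1) := by
  classical
  have hex : ∃ j, s ≤ gridPoint t K j := ⟨K, by
    unfold gridPoint
    rwa [mul_div_assoc, div_self (by positivity), mul_one]⟩
  have hle : Nat.find hex ≤ K := Nat.find_min' hex (by
    unfold gridPoint
    rwa [mul_div_assoc, div_self (by positivity), mul_one])
  have hne : Nat.find hex ≠ 0 := fun h => by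
    have := Nat.find_spec hex
    rw [h] at this
    simp [gridPoint] at this
    exact hs.ne' this
  refine ⟨⟨Nat.find hex - 1, by omega⟩, ?_, ?_⟩
  · exact lt_of_not_ge (Nat.find_min hex (m := Nat.find hex - 1) (by omega))
  · have := Nat.find_spec hex
    rwa [show Nat.find hex - 1 + 1 = Nat.find hex by omega]

lemma tendsto_gridStep (t : ℝ≥0) : Tendsto (fun K : ℕ => (t / K : ℝ≥0)) atTop (𝓝 0) := by
  exact tendsto_const_div_atTop_nhds_zero_nat t

/-- On a fine grid each large increment contains a large flight in its half-open cell, and distinct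
cells are disjoint. -/
lemma eventually_encard_gridIncrement_le {f : ℝ≥0 → ℝ} (hf : Monotone f)
    (hc : ∀ s, ContinuousWithinAt f (Set.Ici s) s) {x : ℝ} (hx : 0 < x) (t : ℝ≥0) :
    ∀ᶠ K : ℕ in atTop, {i : Fin K | x ≤ gridIncrement f t K i}.encard ≤
      {s : ℝ≥0 | s ∈ Set.Icc 0 t ∧ x ≤ flight f s}.encard := by
  obtain ⟨δ, hδ, h⟩ := exists_flight_of_le_sub hf hc hx t
  have hev : ∀ᶠ K : ℕ in atTop, ((t / K : ℝ≥0) : ℝ) < δ := by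
    exact (NNReal.tendsto_coe.2 (tendsto_gridStep t)).eventually (gt_mem_nhds (by simpa using hδ))
  filter_upwards [hev] with K hK
  have key : ∀ i ∈ {i : Fin K | x ≤ gridIncrement f t K i}, ∃ s, gridPoint t K i < s ∧
      s ≤ gridPoint t K (i + 1) ∧ x ≤ flight f s := fun i hi =>
    h _ _ (gridPoint_mono t K (Nat.le_succ _)) (gridPoint_le i.2) (by
      rw [gridPoint_succ, NNReal.dist_eq]
      push_cast at hK ⊢
      rw [add_sub_cancel_left, abs_of_nonneg (by positivity)]
      exact hK) hi
  choose! σ h1 h2 h3 using key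
  refine Set.encard_le_encard_of_injOn (f := σ)
    (fun i hi => ⟨⟨zero_le, (h2 i hi).trans (gridPoint_le i.2)⟩, h3 i hi⟩) ?_
  have aux : ∀ i ∈ {i : Fin K | x ≤ gridIncrement f t K i},
      ∀ j ∈ {i : Fin K | x ≤ gridIncrement f t K i}, i < j → σ i < σ j := fun i hi j hj hij =>
    ((h2 i hi).trans (gridPoint_mono t K (Nat.succ_le_of_lt hij))).trans_lt (h1 j hj)
  intro i hi j hj hij
  rcases lt_trichotomy i j with hl | hl | hl
  · exact absurd hij (aux i hi j hj hl).ne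
  · exact hl
  · exact absurd hij.symm (aux j hj i hi hl).ne

/-- Finitely many flight times are eventually separated by more than the mesh, so they lie in
distinct cells; by monotonicity the increment over a cell dominates each flight in it. -/
lemma eventually_le_encard_gridIncrement {f : ℝ≥0 → ℝ} (hf : Monotone f) {x : ℝ} (hx : 0 < x)
    (t : ℝ≥0) {n : ℕ} (hn : (n : ℕ∞) ≤ {s : ℝ≥0 | s ∈ Set.Icc 0 t ∧ x ≤ flight f s}.encard) :
    ∀ᶠ K : ℕ in atTop, (n : ℕ∞) ≤ {i : Fin K | x ≤ gridIncrement f t K i}.encard := by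
  obtain ⟨T, hT, hTn⟩ := Set.exists_subset_encard_eq hn
  have hfin : T.Finite := Set.finite_of_encard_eq_coe hTn
  have hsep : ∀ᶠ K : ℕ in atTop, ∀ s ∈ T, ∀ s' ∈ T, s < s' → s + t / K < s' := by
    rw [eventually_all_finite hfin]
    intro s _
    rw [eventually_all_finite hfin]
    intro s' _
    by_cases hs : s < s'
    · have : Tendsto (fun K : ℕ => s + (t / K : ℝ≥0)) atTop (𝓝 (s + 0)) :=
        tendsto_const_nhds.add (tendsto_gridStep t)
      rw [add_zero] at this
      filter_upwards [this.eventually (gt_mem_nhds hs)] with K hK _ using hK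
    · exact Eventually.of_forall fun K h => absurd h hs
  filter_upwards [hsep, eventually_gt_atTop 0] with K hK hK0
  have key : ∀ s ∈ T, ∃ i : Fin K, gridPoint t K i < s ∧ s ≤ gridPoint t K (i + 1) := by
    intro s hs
    have hs' := hT hs
    refine exists_gridPoint_lt_le ?_ hs'.1.2 hK0
    rcases eq_or_lt_of_le (zero_le (a := s)) with h0 | h0
    · have := hs'.2
      rw [← h0, flight_zero] at this
      exact absurd this (not_le.2 hx)
    · exact h0
  have : Nonempty (Fin K) := ⟨⟨0, hK0⟩⟩
  choose! σ h1 h2 using key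
  rw [← hTn]
  refine Set.encard_le_encard_of_injOn (f := σ)
    (fun s hs => (hT hs).2.trans (flight_le_sub hf (h1 s hs) (h2 s hs))) ?_
  have aux : ∀ s ∈ T, ∀ s' ∈ T, s < s' → σ s ≠ σ s' := by
    intro s hs s' hs' hlt heq
    have h3 := h2 s' hs'
    rw [← heq, gridPoint_succ] at h3
    have h4 := hK s hs s' hs' hlt
    exact absurd (h4.trans_le h3) (not_lt.2 (by gcongr; exact (h1 s hs).le))
  intro s hs s' hs' heq
  rcases lt_trichotomy s s' with hl | hl | hl
  · exact absurd heq (aux s hs s' hs' hl)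
  · exact hl
  · exact absurd heq.symm (aux s' hs' s hs hl)

lemma eventually_le_encard_gridIncrement_iff {f : ℝ≥0 → ℝ} (hf : Monotone f)
    (hc : ∀ s, ContinuousWithinAt f (Set.Ici s) s) {x : ℝ} (hx : 0 < x) (t : ℝ≥0) (n : ℕ) :
    ∀ᶠ K : ℕ in atTop, ((n : ℕ∞) ≤ {i : Fin K | x ≤ gridIncrement f t K i}.encard ↔
      (n : ℕ∞) ≤ {s : ℝ≥0 | s ∈ Set.Icc 0 t ∧ x ≤ flight f s}.encard) := by
  by_cases hn : (n : ℕ∞) ≤ {s : ℝ≥0 | s ∈ Set.Icc 0 t ∧ x ≤ flight f s}.encard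
  · filter_upwards [eventually_le_encard_gridIncrement hf hx t hn] with K hK
    exact ⟨fun _ => hn, fun _ => hK⟩
  · filter_upwards [eventually_encard_gridIncrement_le hf hc hx t] with K hK
    exact ⟨fun h => h.trans hK, fun h => absurd h hn⟩

lemma le_nthLargestFlight {f : ℝ≥0 → ℝ} (hf : Monotone f) {n : ℕ} (hn : 1 ≤ n) {t : ℝ≥0} {x : ℝ}
    (hx : 0 < x) (h : (n : ℕ∞) ≤ {s : ℝ≥0 | s ∈ Set.Icc 0 t ∧ x ≤ flight f s}.encard) :
    x ≤ nthLargestFlight f n t := by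
  refine le_csSup ⟨f t - f 0, ?_⟩ ⟨hx, h⟩
  rintro y ⟨-, hy⟩
  have : {s : ℝ≥0 | s ∈ Set.Icc 0 t ∧ y ≤ flight f s}.Nonempty := by
    rw [← Set.encard_pos]
    exact lt_of_lt_of_le (by exact_mod_cast hn) hy
  obtain ⟨s, hs, hys⟩ := this
  exact hys.trans (flight_le_of_le hf hs.2)

lemma le_encard_of_lt_nthLargestFlight {f : ℝ≥0 → ℝ} {n : ℕ} {t : ℝ≥0} {x : ℝ}
    (hx : 0 < x) (h : x < nthLargestFlight f n t) :
    (n : ℕ∞) ≤ {s : ℝ≥0 | s ∈ Set.Icc 0 t ∧ x ≤ flight f s}.encard := by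
  have hne : {x : ℝ | 0 < x ∧
      (n : ℕ∞) ≤ {s : ℝ≥0 | s ∈ Set.Icc 0 t ∧ x ≤ flight f s}.encard}.Nonempty := by
    by_contra h0
    rw [Set.not_nonempty_iff_eq_empty] at h0
    rw [nthLargestFlight, h0, Real.sSup_empty] at h
    exact absurd h (not_lt.2 hx.le)
  obtain ⟨y, hy, hxy⟩ := exists_lt_of_lt_csSup hne h
  exact hy.2.trans (Set.encard_le_encard fun s hs => ⟨hs.1, hxy.le.trans hs.2⟩)

/-- The hypothesis `hv` says that `v K` is the n-th largest grid increment, as far as positive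
thresholds can tell. For a fixed threshold on either side of the limit, the counts of increments and
of flights eventually reach n simultaneously. -/
lemma tendsto_nthLargestFlight {f : ℝ≥0 → ℝ} (hf : Monotone f)
    (hc : ∀ s, ContinuousWithinAt f (Set.Ici s) s) {n : ℕ} (hn : 1 ≤ n) {t : ℝ≥0}
    (hpos : 0 < nthLargestFlight f n t) {v : ℕ → ℝ}
    (hv : ∀ᶠ K in atTop, ∀ x > 0,
      ((n : ℕ∞) ≤ {i : Fin K | x ≤ gridIncrement f t K i}.encard ↔ x ≤ v K)) :
    Tendsto v atTop (𝓝 (nthLargestFlight f n t)) := by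
  refine tendsto_order.2 ⟨fun y hy => ?_, fun y hy => ?_⟩
  · obtain ⟨x, hx, hxn⟩ := exists_between (max_lt hy hpos)
    have hx0 : 0 < x := (le_max_right _ _).trans_lt hx
    filter_upwards [hv, eventually_le_encard_gridIncrement_iff hf hc hx0 t n] with K hK hK'
    exact ((le_max_left _ _).trans_lt hx).trans_le
      ((hK x hx0).1 (hK'.2 (le_encard_of_lt_nthLargestFlight hx0 hxn)))
  · have hy0 := hpos.trans hy
    filter_upwards [hv, eventually_le_encard_gridIncrement_iff hf hc hy0 t n] with K hK hK'
    by_contra h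
    push Not at h
    exact absurd (le_nthLargestFlight hf hn hy0 (hK'.1 ((hK y hy0).2 h))) (not_le.2 hy)

/-- Non-negativity of increments holds almost surely only for countably many pairs of times at once;
right continuity extends it to all pairs. -/
lemma monotone_of_forall_rat {f : ℝ≥0 → ℝ} (hc : ∀ s, ContinuousWithinAt f (Set.Ici s) s)
    (h : ∀ p q : ℚ≥0, p ≤ q → f p ≤ f q) : Monotone f := by
  have dense : ∀ a b : ℝ≥0, a < b → ∃ q : ℚ≥0, a < q ∧ (q : ℝ≥0) < b := fun a b hab => by
    obtain ⟨q, h1, h2⟩ := exists_rat_btwn (NNReal.coe_lt_coe.2 hab)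
    have hq : 0 ≤ q := by
      have : (0 : ℝ) < q := a.2.trans_lt h1
      exact_mod_cast this.le
    lift q to ℚ≥0 using hq
    refine ⟨q, ?_, ?_⟩
    · rw [← NNReal.coe_lt_coe]; exact_mod_cast h1
    · rw [← NNReal.coe_lt_coe]; exact_mod_cast h2
  have near : ∀ (s b : ℝ≥0) (U : Set ℝ), U ∈ 𝓝 (f s) → s < b →
      ∃ q : ℚ≥0, s < q ∧ (q : ℝ≥0) < b ∧ f q ∈ U := fun s b U hU hb => by
    obtain ⟨u, hu, hsub⟩ := (mem_nhdsGE_iff_exists_Ico_subset' hb).1 ((hc s) hU)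
    obtain ⟨q, hq1, hq2⟩ := dense s (min u b) (lt_min hu hb)
    exact ⟨q, hq1, hq2.trans_le (min_le_right _ _),
      hsub ⟨hq1.le, hq2.trans_le (min_le_left _ _)⟩⟩
  intro s t hst
  rcases hst.eq_or_lt with rfl | hst
  · exact le_rfl
  by_contra hlt
  push Not at hlt
  obtain ⟨m, hm1, hm2⟩ := exists_between hlt
  obtain ⟨q, _, hq, hqm⟩ := near s t (Set.Ioi m) (Ioi_mem_nhds hm2) hst
  obtain ⟨r, hr, _, hrm⟩ := near t (t + 1) (Set.Iio m) (Iio_mem_nhds hm1) (by simp)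
  have : q ≤ r := by
    have h1 : (q : ℝ≥0) < r := hq.trans hr
    exact_mod_cast h1.le
  have := h q r this
  simp only [Set.mem_Ioi, Set.mem_Iio] at hqm hrm
  linarith

/-! ### Order statistics of independent uniform random variables -/

lemma setLIntegral_Ioo_zero_eq_mul {v : ℝ} (hv : 0 < v) (h : ℝ → ℝ≥0∞) :
    ∫⁻ u in Set.Ioo 0 v, h u = ENNReal.ofReal v * ∫⁻ x in Set.Ioo 0 1, h (v * x) := by
  have he : MeasurableEmbedding (fun x : ℝ => v * x) :=
    (Homeomorph.mulLeft₀ v hv.ne').measurableEmbedding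
  conv_lhs => rw [← Real.smul_map_volume_mul_left hv.ne']
  rw [Measure.restrict_smul, lintegral_smul_measure, he.restrict_map, he.lintegral_map,
    abs_of_pos hv, smul_eq_mul]
  congr 3
  ext x
  simp only [Set.mem_preimage, Set.mem_Ioo]
  constructor
  · rintro ⟨h1, h2⟩
    exact ⟨(mul_pos_iff_of_pos_left hv).1 h1, by nlinarith⟩
  · rintro ⟨h1, h2⟩
    exact ⟨by positivity, by nlinarith⟩

lemma setLIntegral_Ioo_rpow_mul_rpow {a b : ℝ} (ha : 0 < a) (hb : 0 < b) :
    ∫⁻ x in Set.Ioo 0 1, ENNReal.ofReal (x ^ (a - 1) * (1 - x) ^ (b - 1)) =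
      ENNReal.ofReal (beta a b) := by
  have h1 := lintegral_betaPDF_eq_one ha hb
  have hpos := beta_pos ha hb
  rw [lintegral_betaPDF] at h1
  have h2 : ∀ x : ℝ, ENNReal.ofReal (x ^ (a - 1) * (1 - x) ^ (b - 1)) =
      ENNReal.ofReal (beta a b) *
        ENNReal.ofReal (1 / beta a b * x ^ (a - 1) * (1 - x) ^ (b - 1)) := fun x => by
    rw [← ENNReal.ofReal_mul hpos.le]
    congr 1
    field_simp
  simp_rw [h2]
  rw [lintegral_const_mul _ (by fun_prop), h1, mul_one]

/-- The weight u^n (v-u)^m is the probability that n prescribed uniform points fall below u and m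
others between u and v. After scaling by v, the exponent q enters only through the Beta factor. -/
lemma setLIntegral_Ioo_ratio_rpow {q : ℝ} (hq : 0 ≤ q) (n m : ℕ) {v : ℝ} (hv : 0 < v) :
    ∫⁻ u in Set.Ioo 0 v,
        ENNReal.ofReal ((u / v) ^ q) * (ENNReal.ofReal u ^ n * ENNReal.ofReal (v - u) ^ m) =
      ENNReal.ofReal (beta (n + 1 + q) (m + 1)) * ENNReal.ofReal v ^ (n + m + 1) := by
  rw [setLIntegral_Ioo_zero_eq_mul hv]
  have h : ∀ x ∈ Set.Ioo (0 : ℝ) 1, ENNReal.ofReal ((v * x / v) ^ q) *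
      (ENNReal.ofReal (v * x) ^ n * ENNReal.ofReal (v - v * x) ^ m) =
      ENNReal.ofReal v ^ (n + m) *
        ENNReal.ofReal (x ^ ((n + 1 + q : ℝ) - 1) * (1 - x) ^ ((m + 1 : ℝ) - 1)) := by
    rintro x ⟨hx0, hx1⟩
    have h1x : 0 < 1 - x := by linarith
    rw [mul_div_cancel_left₀ _ hv.ne', ← mul_one_sub, ← ENNReal.ofReal_pow (by positivity),
      ← ENNReal.ofReal_pow (by positivity), ← ENNReal.ofReal_pow (by positivity),
      ← ENNReal.ofReal_mul (by positivity), ← ENNReal.ofReal_mul (by positivity),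
      ← ENNReal.ofReal_mul (by positivity)]
    congr 1
    rw [show (n + 1 + q : ℝ) - 1 = n + q by ring, Real.rpow_add hx0, Real.rpow_natCast,
      add_sub_cancel_right, Real.rpow_natCast, mul_pow, mul_pow]
    ring
  rw [setLIntegral_congr_fun measurableSet_Ioo h, lintegral_const_mul _ (by fun_prop),
    setLIntegral_Ioo_rpow_mul_rpow (by positivity) (by positivity)]
  ring

lemma beta_ratio (n m : ℕ) {q : ℝ} (hq : 0 ≤ q) :
    beta (n + 1 + q) (m + 1) = (∏ k ∈ Finset.Ico (n + 1) (n + m + 2), (k : ℝ) / (k + q)) *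
      beta (n + 1) (m + 1) := by
  have key : ∀ (r : ℝ), 0 ≤ r → Real.Gamma (n + 1 + r + (m + 1)) =
      (∏ k ∈ Finset.Ico (n + 1) (n + m + 2), ((k : ℝ) + r)) * Real.Gamma (n + 1 + r) := by
    intro r hr
    have : ∀ j : ℕ, Real.Gamma (n + 1 + r + j) =
        (∏ k ∈ Finset.Ico (n + 1) (n + 1 + j), ((k : ℝ) + r)) * Real.Gamma (n + 1 + r) := by
      intro j
      induction j with
      | zero => simp
      | succ j ih =>
        rw [← add_assoc (n + 1) j 1, Finset.prod_Ico_succ_top (by omega), Nat.cast_succ,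
          ← add_assoc, Real.Gamma_add_one (by positivity), ih]
        push_cast
        ring
    have h := this (m + 1)
    rw [show n + 1 + (m + 1) = n + m + 2 by ring] at h
    rw [← h]
    push_cast
    rfl
  have k1 := key q hq
  have k0 := key 0 le_rfl
  simp only [add_zero] at k0
  have hg1 : Real.Gamma (n + 1 + q) ≠ 0 := (Real.Gamma_pos_of_pos (by positivity)).ne'
  have hg0 : Real.Gamma (n + 1) ≠ 0 := (Real.Gamma_pos_of_pos (by positivity)).ne'
  have hp1 : (∏ k ∈ Finset.Ico (n + 1) (n + m + 2), ((k : ℝ) + q)) ≠ 0 := by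
    refine Finset.prod_ne_zero_iff.2 fun k hk => ?_
    have : 1 ≤ k := by have := Finset.mem_Ico.1 hk; omega
    positivity
  have hp0 : (∏ k ∈ Finset.Ico (n + 1) (n + m + 2), (k : ℝ)) ≠ 0 := by
    refine Finset.prod_ne_zero_iff.2 fun k hk => ?_
    have : 1 ≤ k := by have := Finset.mem_Ico.1 hk; omega
    positivity
  unfold beta
  rw [k1, k0, Finset.prod_div_distrib]
  field_simp

/-- The number of entries of `a` smaller than `a i`. -/
noncomputable def rankOf {ι : Type*} [Fintype ι] (a : ι → ℝ) (i : ι) : ℕ :=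
  (Finset.univ.filter fun l => a l < a i).card

lemma rankOf_lt_iff {ι : Type*} [Fintype ι] (a : ι → ℝ) (i j : ι) :
    rankOf a i < rankOf a j ↔ a i < a j := by
  classical
  have mono : ∀ i j, a i ≤ a j → rankOf a i ≤ rankOf a j := fun i j h =>
    Finset.card_le_card (Finset.monotone_filter_right _ fun l _ hl => hl.trans_le h)
  constructor
  · intro h
    by_contra h'
    exact absurd (mono j i (not_lt.1 h')) (not_le.2 h)
  · intro h
    refine Finset.card_lt_card (Finset.ssubset_iff_of_subset
      (Finset.monotone_filter_right _ fun l _ hl => lt_trans hl h) |>.2 ⟨i, ?_, ?_⟩)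
    · simpa using h
    · simp

lemma rankOf_injective {ι : Type*} [Fintype ι] {a : ι → ℝ} (ha : Function.Injective a) :
    Function.Injective (rankOf a) := by
  intro i j h
  apply ha
  have h1 := rankOf_lt_iff a i j
  have h2 := rankOf_lt_iff a j i
  exact le_antisymm (not_lt.1 fun h' => absurd (h2.2 h') (by omega))
    (not_lt.1 fun h' => absurd (h1.2 h') (by omega))

lemma exists_rankOf_eq {ι : Type*} [Fintype ι] {a : ι → ℝ} (ha : Function.Injective a)
    {n : ℕ} (hn : n < Fintype.card ι) : ∃ i, rankOf a i = n := by
  classical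
  have hlt : ∀ i, rankOf a i < Fintype.card ι := fun i =>
    Finset.card_lt_univ_of_notMem (x := i) (by simp)
  let g : ι → Fin (Fintype.card ι) := fun i => ⟨rankOf a i, hlt i⟩
  have hg : Function.Injective g := fun i j h => rankOf_injective ha (Fin.mk.inj_iff.1 h)
  have hb := (Fintype.bijective_iff_injective_and_card g).2 ⟨hg, by simp⟩
  obtain ⟨i, hi⟩ := hb.2 ⟨n, hn⟩
  exact ⟨i, Fin.mk.inj_iff.1 hi⟩

lemma measurable_rankOf {ι : Type*} [Fintype ι] (i : ι) :
    Measurable fun a : ι → ℝ => rankOf a i := by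
  classical
  have : (fun a : ι → ℝ => rankOf a i) = fun a => ∑ l, if a l < a i then 1 else 0 := by
    ext a
    rw [rankOf, Finset.card_filter]
  rw [this]
  exact Finset.measurable_sum _ fun l _ => Measurable.ite
    (measurableSet_lt (measurable_pi_apply l) (measurable_pi_apply i))
    measurable_const measurable_const

/-- The position of `x` with respect to `u` and `v`. -/
noncomputable def cell (u v x : ℝ) : Fin 3 := if x < u then 0 else if x < v then 1 else 2

lemma cell_eq_zero_iff {u v x : ℝ} : cell u v x = 0 ↔ x < u := by
  unfold cell; split_ifs <;> simp [*]

lemma cell_eq_one_iff {u v x : ℝ} : cell u v x = 1 ↔ u ≤ x ∧ x < v := by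
  unfold cell; split_ifs <;> simp_all

lemma cell_eq_two_iff {u v x : ℝ} (h : u < v) : cell u v x = 2 ↔ v ≤ x := by
  unfold cell; split_ifs <;> simp_all
  exact lt_trans ‹_› h

lemma measurable_cell (u v : ℝ) : Measurable (cell u v) :=
  Measurable.ite measurableSet_Iio measurable_const
    (Measurable.ite measurableSet_Iio measurable_const measurable_const)

/-- Both ranks depend only on the cells into which the other points fall; the final 1 counts `i`
itself, which lies below `j`. -/
lemma rankOf_eq_sum_cell {ι : Type*} [Fintype ι] [DecidableEq ι] {i j : ι} (hij : i ≠ j)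
    {a : ι → ℝ} (h : a i < a j) :
    rankOf a i = (Finset.univ.filter
      fun l : ({i, j}ᶜ : Finset ι) => cell (a i) (a j) (a l) = 0).card ∧
    rankOf a j = (Finset.univ.filter
      fun l : ({i, j}ᶜ : Finset ι) => cell (a i) (a j) (a l) = 0).card +
      (Finset.univ.filter
        fun l : ({i, j}ᶜ : Finset ι) => cell (a i) (a j) (a l) = 1).card + 1 := by
  have split : ∀ g : ι → ℕ, ∑ l, g l = g i + g j + ∑ l : ({i, j}ᶜ : Finset ι), g l := fun g => by
    rw [Finset.sum_coe_sort ({i, j}ᶜ : Finset ι) g, ← Finset.sum_pair hij,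
      Finset.sum_add_sum_compl]
  constructor
  · simp only [rankOf, Finset.card_filter, cell_eq_zero_iff]
    rw [split]
    simp [h.le]
  · simp only [rankOf, Finset.card_filter, cell_eq_zero_iff, cell_eq_one_iff]
    rw [split, ← Finset.sum_add_distrib]
    simp only [h, if_true, lt_irrefl, if_false, add_zero]
    rw [add_comm]
    congr 1
    refine Finset.sum_congr rfl fun l _ => ?_
    by_cases h1 : a l < a i
    · simp [h1, h1.trans h, not_le.2 h1]
    · simp [h1, not_lt.1 h1]

/-- Given the values u < v at `i` and `j`, the remaining points fall independently into the three
cells with probabilities u, v-u and 1-v. Integrating over u leaves a Beta factor times a quantity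
`D` free of q. The value of `D` is not needed: the case q = 0 will normalise the sum. -/
lemma lintegral_rankOf_ratio {ι : Type*} [Fintype ι] [DecidableEq ι] {i j : ι} (hij : i ≠ j)
    (n m : ℕ) :
    ∃ D : ℝ≥0∞, ∀ q : ℝ, 0 ≤ q →
      ∫⁻ a, (if rankOf a i = n ∧ rankOf a j = n + m + 1 then ENNReal.ofReal ((a i / a j) ^ q)
        else 0) ∂(Measure.pi fun _ : ι => volume.restrict (Set.Ioo (0 : ℝ) 1)) =
      ENNReal.ofReal (beta (n + 1 + q) (m + 1)) * D := by
  let rest : Finset ι := {i, j}ᶜ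
  let good : Finset (rest → Fin 3) := Finset.univ.filter fun c =>
    (Finset.univ.filter fun l => c l = 0).card = n ∧
      (Finset.univ.filter fun l => c l = 1).card = m
  -- The contribution of the points above v, summed over all admissible assignments to cells.
  let H : ℝ → ℝ≥0∞ := fun v =>
    ∑ c ∈ good, ENNReal.ofReal (1 - v) ^ (Finset.univ.filter fun l => c l = 2).card
  have hH : Measurable H := by fun_prop
  refine ⟨∫⁻ v in Set.Ioo 0 1, ENNReal.ofReal v ^ (n + m + 1) * H v, fun q hq => ?_⟩
  set U : Measure ℝ := volume.restrict (Set.Ioo (0 : ℝ) 1) with hU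
  set f : (ι → ℝ) → ℝ≥0∞ := fun a =>
    if rankOf a i = n ∧ rankOf a j = n + m + 1 then ENNReal.ofReal ((a i / a j) ^ q) else 0 with hf
  have hfm : Measurable f := by
    refine Measurable.ite ?_ (by fun_prop) measurable_const
    exact ((measurable_rankOf i) (measurableSet_singleton n)).inter
      ((measurable_rankOf j) (measurableSet_singleton (n + m + 1)))
  have hfc : ∀ a, f a = if a i < a j then ENNReal.ofReal ((a i / a j) ^ q) *
      (if (fun l : rest => cell (a i) (a j) (a l)) ∈ good then 1 else 0) else 0 := by
    intro a
    by_cases h : a i < a j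
    · obtain ⟨h1, h2⟩ := rankOf_eq_sum_cell hij h
      have : (rankOf a i = n ∧ rankOf a j = n + m + 1) ↔
          (fun l : rest => cell (a i) (a j) (a l)) ∈ good := by
        simp only [good, Finset.mem_filter, Finset.mem_univ, true_and, rest]
        omega
      simp only [hf, this, h, if_true]
      split_ifs <;> simp
    · have : ¬ (rankOf a i = n ∧ rankOf a j = n + m + 1) := fun h' =>
        h ((rankOf_lt_iff a i j).1 (by omega))
      simp only [hf, this, h, if_false]
  have inner : ∀ u v : ℝ, 0 < u → u < v → v < 1 →
      ∫⁻ y : rest → ℝ, (if (fun l : rest => cell u v (y l)) ∈ good then 1 else 0)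
        ∂(Measure.pi fun _ => U) =
      ENNReal.ofReal u ^ n * ENNReal.ofReal (v - u) ^ m * H v := by
    intro u v hu huv hv
    have : IsFiniteMeasure U := ⟨by simp [hU]⟩
    let φ : (rest → Fin 3) → ℝ≥0∞ := fun c => if c ∈ good then 1 else 0
    have hmap := Measure.pi_map_pi (μ := fun _ : rest => U) (f := fun _ => cell u v)
      (fun _ => (measurable_cell u v).aemeasurable)
    have h1 : ∫⁻ y : rest → ℝ, (if (fun l : rest => cell u v (y l)) ∈ good then 1 else 0)
        ∂(Measure.pi fun _ => U) = ∫⁻ c, φ c ∂(Measure.pi fun _ : rest => U.map (cell u v)) := by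
      have hm : Measurable fun (y : rest → ℝ) l => cell u v (y l) :=
        measurable_pi_lambda _ fun l => (measurable_cell u v).comp (measurable_pi_apply l)
      rw [← hmap, lintegral_map (measurable_of_finite _) hm]
    have e0 : U.map (cell u v) {0} = ENNReal.ofReal u := by
      rw [Measure.map_apply (measurable_cell u v) (measurableSet_singleton _),
        show cell u v ⁻¹' {0} = Set.Iio u by ext; simp [cell_eq_zero_iff], hU,
        Measure.restrict_apply measurableSet_Iio,
        show Set.Iio u ∩ Set.Ioo 0 1 = Set.Ioo 0 u by ext x; simp; grind,
        Real.volume_Ioo, sub_zero]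
    have e1 : U.map (cell u v) {1} = ENNReal.ofReal (v - u) := by
      rw [Measure.map_apply (measurable_cell u v) (measurableSet_singleton _),
        show cell u v ⁻¹' {1} = Set.Ico u v by ext; simp [cell_eq_one_iff], hU,
        Measure.restrict_apply measurableSet_Ico,
        show Set.Ico u v ∩ Set.Ioo 0 1 = Set.Ico u v by ext x; simp; grind,
        Real.volume_Ico]
    have e2 : U.map (cell u v) {2} = ENNReal.ofReal (1 - v) := by
      rw [Measure.map_apply (measurable_cell u v) (measurableSet_singleton _),
        show cell u v ⁻¹' {2} = Set.Ici v by ext; simp [cell_eq_two_iff huv], hU,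
        Measure.restrict_apply measurableSet_Ici,
        show Set.Ici v ∩ Set.Ioo 0 1 = Set.Ico v 1 by ext x; simp; grind,
        Real.volume_Ico]
    rw [h1, lintegral_fintype, Finset.mul_sum]
    simp only [φ, ite_mul, one_mul, zero_mul]
    rw [Finset.sum_ite_mem, Finset.univ_inter]
    refine Finset.sum_congr rfl fun c hc => ?_
    have hc' := (Finset.mem_filter.1 hc).2
    -- Grouping the points by cell turns the product into powers of the three cell probabilities.
    rw [Measure.pi_singleton, ← Finset.prod_fiberwise _ c]
    have : ∀ k : Fin 3, ∏ l with c l = k, U.map (cell u v) {c l} =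
        U.map (cell u v) {k} ^ (Finset.univ.filter fun l => c l = k).card := fun k =>
      Finset.prod_eq_pow_card fun l hl => by rw [(Finset.mem_filter.1 hl).2]
    simp only [this]
    rw [Fin.prod_univ_three, e0, e1, e2, hc'.1, hc'.2]
  have hi : i ∉ rest := by simp [rest]
  have hj : j ∉ insert i rest := by simp [rest, hij.symm]
  have huniv : (Finset.univ : Finset ι) = insert j (insert i rest) := by
    ext l; simp only [rest, Finset.mem_univ, Finset.mem_insert, Finset.mem_compl,
      Finset.mem_singleton, true_iff]; tauto
  -- Fubini: v (coordinate `j`) is the outermost variable, then u (coordinate `i`), then the rest.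
  rw [lintegral_eq_lmarginal_univ (0 : ι → ℝ), huniv, lmarginal_insert f hfm hj]
  simp_rw [lmarginal_insert f hfm hi]
  rw [← lintegral_const_mul _ (by fun_prop)]
  refine setLIntegral_congr_fun measurableSet_Ioo fun v hv => ?_
  have hval : ∀ u, (∫⋯∫⁻_rest, f ∂fun _ => U)
      (Function.update (Function.update (0 : ι → ℝ) j v) i u) =
      if u < v then ENNReal.ofReal ((u / v) ^ q) *
        ∫⁻ y : rest → ℝ, (if (fun l : rest => cell u v (y l)) ∈ good then 1 else 0)
        ∂(Measure.pi fun _ => U) else 0 := by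
    intro u
    have hjr : j ∉ rest := by simp [rest]
    have ej : ∀ y : rest → ℝ, Function.updateFinset
        (Function.update (Function.update (0 : ι → ℝ) j v) i u) rest y j = v := fun y => by
      simp [Function.updateFinset, hjr, hij.symm]
    have ei : ∀ y : rest → ℝ, Function.updateFinset
        (Function.update (Function.update (0 : ι → ℝ) j v) i u) rest y i = u := fun y => by
      simp [Function.updateFinset, hi]
    have el : ∀ (y : rest → ℝ) (l : rest), Function.updateFinset
        (Function.update (Function.update (0 : ι → ℝ) j v) i u) rest y l = y l := fun y l => by
      simp [Function.updateFinset]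
    simp only [lmarginal, hfc, ei, ej, el]
    split_ifs
    · rw [lintegral_const_mul']
      exact ENNReal.ofReal_ne_top
    · simp
  have hset : ∫⁻ u, (∫⋯∫⁻_rest, f ∂fun _ => U)
      (Function.update (Function.update (0 : ι → ℝ) j v) i u) ∂U =
      ∫⁻ u in Set.Ioo 0 v, ENNReal.ofReal ((u / v) ^ q) *
        (ENNReal.ofReal u ^ n * ENNReal.ofReal (v - u) ^ m) * H v := by
    simp_rw [hval]
    rw [hU, ← lintegral_indicator measurableSet_Ioo, ← lintegral_indicator measurableSet_Ioo]
    refine lintegral_congr fun u => ?_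
    simp only [Set.indicator_apply, Set.mem_Ioo]
    by_cases h : 0 < u ∧ u < v
    · rw [if_pos ⟨h.1, h.2.trans hv.2⟩, if_pos h.2, if_pos h, ← hU, inner u v h.1 h.2 hv.2]
      ring
    · rw [if_neg h]
      by_cases h0 : 0 < u
      · rw [if_neg fun h' => h ⟨h0, h'⟩, ite_self]
      · rw [if_neg fun h' => h0 h'.1]
  simp only [hset]
  rw [lintegral_mul_const _ (by fun_prop), setLIntegral_Ioo_ratio_rpow hq n m hv.1, mul_assoc]

/-- A tie confines the point to a proper linear subspace, which is Lebesgue null. -/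
lemma ae_injective_pi_uniform (ι : Type*) [Fintype ι] :
    ∀ᵐ a ∂(Measure.pi fun _ : ι => volume.restrict (Set.Ioo (0 : ℝ) 1)),
      Function.Injective a := by
  classical
  have h : ∀ i j : ι, i ≠ j → ∀ᵐ a ∂(volume : Measure (ι → ℝ)), a i ≠ a j := by
    intro i j hij
    let p : Submodule ℝ (ι → ℝ) := LinearMap.ker
      ((LinearMap.proj i : (ι → ℝ) →ₗ[ℝ] ℝ) - LinearMap.proj j)
    have hp : p ≠ ⊤ := by
      intro htop
      have : Pi.single i (1 : ℝ) ∈ p := htop ▸ Submodule.mem_top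
      simp [p, hij.symm] at this
    have h0 := Measure.addHaar_submodule volume p hp
    rw [ae_iff]
    convert! h0 using 2
    ext a
    simp [p, sub_eq_zero]
  rw [← Measure.restrict_pi_pi]
  refine ae_restrict_of_ae ?_
  have h' : ∀ᵐ a ∂(Measure.pi fun _ : ι => (volume : Measure ℝ)), ∀ i j : ι, i ≠ j → a i ≠ a j := by
    rw [← volume_pi]
    rw [ae_all_iff]; intro i; rw [ae_all_iff]; intro j
    by_cases hij : i = j
    · simp [hij]
    · filter_upwards [h i j hij] with a ha _ using ha
  filter_upwards [h'] with a ha i j hij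
  by_contra hne
  exact ha i j hne hij

/-- The ratio of the entries of rank `n` and `n + m + 1` of `a`, to the power `q`. -/
noncomputable def rankRatio {ι : Type*} [Fintype ι] (n m : ℕ) (q : ℝ) (a : ι → ℝ) : ℝ≥0∞ :=
  ∑ i, ∑ j, if rankOf a i = n ∧ rankOf a j = n + m + 1 then ENNReal.ofReal ((a i / a j) ^ q)
    else 0

lemma measurable_rankRatio {ι : Type*} [Fintype ι] (n m : ℕ) (q : ℝ) :
    Measurable (rankRatio n m q : (ι → ℝ) → ℝ≥0∞) := by
  refine Finset.measurable_sum _ fun i _ => Finset.measurable_sum _ fun j _ =>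
    Measurable.ite ?_ (by fun_prop) measurable_const
  exact ((measurable_rankOf i) (measurableSet_singleton n)).inter
    ((measurable_rankOf j) (measurableSet_singleton (n + m + 1)))

lemma rankRatio_eq {ι : Type*} [Fintype ι] {n m : ℕ} {q : ℝ} {a : ι → ℝ}
    (ha : Function.Injective a) {i j : ι} (hi : rankOf a i = n) (hj : rankOf a j = n + m + 1) :
    rankRatio n m q a = ENNReal.ofReal ((a i / a j) ^ q) := by
  unfold rankRatio
  rw [Finset.sum_eq_single i, Finset.sum_eq_single j]
  · simp [hi, hj]
  · intro j' _ hne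
    rw [if_neg fun h => hne (rankOf_injective ha (h.2.trans hj.symm))]
  · simp
  · intro i' _ hne
    refine Finset.sum_eq_zero fun j' _ => ?_
    rw [if_neg fun h => hne (rankOf_injective ha (h.1.trans hi.symm))]
  · simp

theorem lintegral_rankRatio {ι : Type*} [Fintype ι] {n m : ℕ} (hK : n + m + 1 < Fintype.card ι)
    {q : ℝ} (hq : 0 ≤ q) :
    ∫⁻ a, rankRatio n m q a ∂(Measure.pi fun _ : ι => volume.restrict (Set.Ioo (0 : ℝ) 1)) =
      ENNReal.ofReal (∏ k ∈ Finset.Ico (n + 1) (n + m + 2), (k : ℝ) / (k + q)) := by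
  classical
  have hex : ∀ i j : ι, ∃ D : ℝ≥0∞, ∀ q : ℝ, 0 ≤ q →
      ∫⁻ a, (if rankOf a i = n ∧ rankOf a j = n + m + 1 then ENNReal.ofReal ((a i / a j) ^ q)
        else 0) ∂(Measure.pi fun _ : ι => volume.restrict (Set.Ioo (0 : ℝ) 1)) =
      ENNReal.ofReal (beta (n + 1 + q) (m + 1)) * D := by
    intro i j
    by_cases hij : i = j
    · refine ⟨0, fun q _ => ?_⟩
      have : ∀ a : ι → ℝ, ¬ (rankOf a i = n ∧ rankOf a j = n + m + 1) := fun a h => by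
        rw [hij] at h; omega
      simp [this]
    · exact lintegral_rankOf_ratio hij n m
  choose D hD using hex
  have hsum : ∀ r : ℝ, 0 ≤ r →
      ∫⁻ a, rankRatio n m r a ∂(Measure.pi fun _ : ι => volume.restrict (Set.Ioo (0 : ℝ) 1)) =
      ENNReal.ofReal (beta (n + 1 + r) (m + 1)) * ∑ i, ∑ j, D i j := by
    intro r hr
    have hm : ∀ i j : ι, Measurable fun a : ι → ℝ =>
        if rankOf a i = n ∧ rankOf a j = n + m + 1 then ENNReal.ofReal ((a i / a j) ^ r)
        else 0 := fun i j => by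
      refine Measurable.ite ?_ (by fun_prop) measurable_const
      exact ((measurable_rankOf i) (measurableSet_singleton n)).inter
        ((measurable_rankOf j) (measurableSet_singleton (n + m + 1)))
    unfold rankRatio
    rw [lintegral_finsetSum _ fun i _ => Finset.measurable_sum _ fun j _ => hm i j,
      Finset.mul_sum]
    refine Finset.sum_congr rfl fun i _ => ?_
    rw [lintegral_finsetSum _ fun j _ => hm i j, Finset.mul_sum]
    exact Finset.sum_congr rfl fun j _ => hD i j r hr
  -- At exponent 0 the ratio is almost surely 1, which determines the unknown total weight.
  have h0 : ENNReal.ofReal (beta (n + 1) (m + 1)) * ∑ i, ∑ j, D i j = 1 := by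
    have h := hsum 0 le_rfl
    rw [add_zero] at h
    rw [← h]
    have : IsProbabilityMeasure (volume.restrict (Set.Ioo (0 : ℝ) 1)) := ⟨by simp⟩
    rw [lintegral_congr_ae (g := fun _ => 1), lintegral_one, measure_univ]
    filter_upwards [ae_injective_pi_uniform ι] with a ha
    obtain ⟨i, hi⟩ := exists_rankOf_eq ha (n := n) (by omega)
    obtain ⟨j, hj⟩ := exists_rankOf_eq ha hK
    rw [rankRatio_eq ha hi hj]
    simp
  rw [hsum q hq, beta_ratio n m hq, ENNReal.ofReal_mul, mul_assoc, h0, mul_one]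
  exact Finset.prod_nonneg fun k _ => by positivity

/-! ### Convergence of measures from Laplace transforms -/

/-- Weierstrass approximation on [0,1]; the zeroth moment keeps the total masses bounded. -/
lemma tendsto_integral_of_tendsto_moments {κ : ℕ → Measure ℝ} {κ' : Measure ℝ}
    [∀ k, IsFiniteMeasure (κ k)] [IsFiniteMeasure κ']
    (hκ : ∀ k, ∀ᵐ x ∂(κ k), x ∈ Set.Icc (0 : ℝ) 1) (hκ' : ∀ᵐ x ∂κ', x ∈ Set.Icc (0 : ℝ) 1)
    (hmom : ∀ j : ℕ, Tendsto (fun k => ∫ x, x ^ j ∂(κ k)) atTop (𝓝 (∫ x, x ^ j ∂κ')))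
    {f : ℝ → ℝ} (hf : Continuous f) :
    Tendsto (fun k => ∫ x, f x ∂(κ k)) atTop (𝓝 (∫ x, f x ∂κ')) := by
  have hint : ∀ (ρ : Measure ℝ) [IsFiniteMeasure ρ], (∀ᵐ x ∂ρ, x ∈ Set.Icc (0 : ℝ) 1) →
      ∀ g : ℝ → ℝ, Continuous g → Integrable g ρ := by
    intro ρ _ hρ g hg
    obtain ⟨C, hC⟩ := isCompact_Icc.exists_bound_of_continuousOn (s := Set.Icc (0 : ℝ) 1)
      hg.continuousOn
    exact Integrable.of_bound hg.aestronglyMeasurable C (hρ.mono fun x hx => hC x hx)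
  have hpoly : ∀ p : Polynomial ℝ, Tendsto (fun k => ∫ x, p.eval x ∂(κ k)) atTop
      (𝓝 (∫ x, p.eval x ∂κ')) := by
    intro p
    have hexp : ∀ (ρ : Measure ℝ) [IsFiniteMeasure ρ], (∀ᵐ x ∂ρ, x ∈ Set.Icc (0 : ℝ) 1) →
        ∫ x, p.eval x ∂ρ = ∑ j ∈ Finset.range (p.natDegree + 1), p.coeff j * ∫ x, x ^ j ∂ρ := by
      intro ρ _ hρ
      simp_rw [Polynomial.eval_eq_sum_range]
      rw [integral_finsetSum _ fun j _ => hint ρ hρ _ (by fun_prop)]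
      simp_rw [integral_const_mul]
    rw [hexp κ' hκ']
    simp_rw [fun k => hexp (κ k) (hκ k)]
    exact tendsto_finsetSum _ fun j _ => (hmom j).const_mul _
  have happ : ∀ (ρ : Measure ℝ) [IsFiniteMeasure ρ], (∀ᵐ x ∂ρ, x ∈ Set.Icc (0 : ℝ) 1) →
      ∀ (p : Polynomial ℝ) (η : ℝ), (∀ x ∈ Set.Icc (0 : ℝ) 1, |p.eval x - f x| < η) →
      |∫ x, p.eval x ∂ρ - ∫ x, f x ∂ρ| ≤ η * ρ.real Set.univ := by
    intro ρ _ hρ p η hp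
    rw [← integral_sub (hint ρ hρ _ p.continuous) (hint ρ hρ f hf)]
    rw [← Real.norm_eq_abs]
    exact norm_integral_le_of_norm_le_const (f := fun x => p.eval x - f x)
      (hρ.mono fun x hx => (hp x hx).le)
  have hmass : Tendsto (fun k => (κ k).real Set.univ) atTop (𝓝 (κ'.real Set.univ)) := by
    simpa using hmom 0
  rw [Metric.tendsto_atTop']
  intro ε hε
  set M := κ'.real Set.univ with hM
  have hM0 : 0 ≤ M := measureReal_nonneg
  -- Eventually the two masses add up to at most 2M + 1, so with this tolerance both approximation
  -- errors together cost at most ε/2.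
  obtain ⟨p, hp⟩ := exists_polynomial_near_of_continuousOn 0 1 f hf.continuousOn
    (ε / (2 * (2 * M + 1))) (by positivity)
  have h1 : ∀ᶠ k in atTop, (κ k).real Set.univ < M + 1 :=
    hmass.eventually (gt_mem_nhds (lt_add_one M))
  have h2 : ∀ᶠ k in atTop, dist (∫ x, p.eval x ∂(κ k)) (∫ x, p.eval x ∂κ') < ε / 2 :=
    (hpoly p).eventually (Metric.ball_mem_nhds _ (half_pos hε))
  obtain ⟨N, hN⟩ := eventually_atTop.1 (h1.and h2)
  refine ⟨N, fun k hk => ?_⟩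
  obtain ⟨h3, h4⟩ := hN k hk.le
  have h5 := happ (κ k) (hκ k) p _ hp
  have h6 := happ κ' hκ' p _ hp
  rw [← hM] at h6
  rw [Real.dist_eq] at h4 ⊢
  have h7 : ε / (2 * (2 * M + 1)) * (κ k).real Set.univ + ε / (2 * (2 * M + 1)) * M ≤ ε / 2 := by
    rw [← mul_add]
    calc ε / (2 * (2 * M + 1)) * ((κ k).real Set.univ + M)
        ≤ ε / (2 * (2 * M + 1)) * (2 * M + 1) :=
          mul_le_mul_of_nonneg_left (by linarith) (by positivity)
      _ = ε / 2 := by field_simp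
  rw [abs_le] at h5 h6
  rw [abs_lt] at h4 ⊢
  constructor <;> linarith [h5.1, h5.2, h6.1, h6.2, h4.1, h4.2]

/-- Under x ↦ exp(-x) the Laplace transform at the integers becomes the moment sequence of a measure
on [0,1], which determines it; the map is then inverted by the logarithm. -/
lemma eq_of_forall_laplace_nat_eq {P Q : Measure ℝ} [IsFiniteMeasure P] [IsFiniteMeasure Q]
    (hP : ∀ᵐ x ∂P, 0 ≤ x) (hQ : ∀ᵐ x ∂Q, 0 ≤ x)
    (h : ∀ j : ℕ, ∫ x, Real.exp (-j * x) ∂P = ∫ x, Real.exp (-j * x) ∂Q) : P = Q := by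
  have hm : Measurable fun x : ℝ => Real.exp (-x) := by fun_prop
  have hsupp : ∀ ρ : Measure ℝ, (∀ᵐ x ∂ρ, 0 ≤ x) →
      ∀ᵐ x ∂(ρ.map fun x => Real.exp (-x)), x ∈ Set.Icc (0 : ℝ) 1 := by
    intro ρ hρ
    rw [ae_map_iff (p := fun x => x ∈ Set.Icc (0 : ℝ) 1) hm.aemeasurable measurableSet_Icc]
    filter_upwards [hρ] with x hx
    exact ⟨(Real.exp_pos _).le, Real.exp_le_one_iff.2 (by linarith)⟩
  have hmom : ∀ (ρ : Measure ℝ) (j : ℕ), ∫ x, x ^ j ∂(ρ.map fun x => Real.exp (-x)) =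
      ∫ x, Real.exp (-j * x) ∂ρ := by
    intro ρ j
    rw [integral_map hm.aemeasurable (by fun_prop)]
    congr 1 with x
    rw [← Real.exp_nat_mul]
    ring_nf
  have hmap : P.map (fun x => Real.exp (-x)) = Q.map (fun x => Real.exp (-x)) := by
    refine ext_of_forall_integral_eq_of_IsFiniteMeasure fun f => ?_
    have := tendsto_integral_of_tendsto_moments (κ := fun _ => P.map fun x => Real.exp (-x))
      (fun _ => hsupp P hP) (hsupp Q hQ) (fun j => by
        simp only [hmom, h]; exact tendsto_const_nhds) f.continuous
    exact tendsto_nhds_unique tendsto_const_nhds this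
  have hinv : ∀ ρ : Measure ℝ, (ρ.map fun x => Real.exp (-x)).map (fun y => -Real.log y) = ρ := by
    intro ρ
    rw [Measure.map_map (by fun_prop) hm]
    have : ((fun y => -Real.log y) ∘ fun x : ℝ => Real.exp (-x)) = id := by
      ext x; simp
    rw [this, Measure.map_id]
  rw [← hinv P, hmap, hinv]

/-- The image under `x ↦ exp (-x)` of the measure with density `1 - exp (-x)`. -/
noncomputable def expImage (ρ : Measure ℝ) : Measure ℝ :=
  (ρ.withDensity fun x => ENNReal.ofReal (1 - Real.exp (-x))).map fun x => Real.exp (-x)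

lemma one_sub_exp_neg_le_min (x : ℝ) : 1 - Real.exp (-x) ≤ min x 1 :=
  le_min (by linarith [Real.add_one_le_exp (-x)]) (by linarith [Real.exp_pos (-x)])

/-- A Lévy measure may have infinite mass near 0; the density vanishes there fast enough to make the
image finite. -/
lemma isFiniteMeasure_expImage {ρ : Measure ℝ}
    (h : ∫⁻ x, ENNReal.ofReal (min x 1) ∂ρ < ∞) : IsFiniteMeasure (expImage ρ) := by
  have : IsFiniteMeasure (ρ.withDensity fun x => ENNReal.ofReal (1 - Real.exp (-x))) :=
    isFiniteMeasure_withDensity ((lintegral_mono fun x =>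
      ENNReal.ofReal_le_ofReal (one_sub_exp_neg_le_min x)).trans_lt h).ne
  unfold expImage
  infer_instance

lemma ae_mem_Icc_expImage {ρ : Measure ℝ} (h : ∀ᵐ x ∂ρ, 0 ≤ x) :
    ∀ᵐ x ∂(expImage ρ), x ∈ Set.Icc (0 : ℝ) 1 := by
  rw [expImage, ae_map_iff (p := fun x => x ∈ Set.Icc (0 : ℝ) 1) (by fun_prop)
    measurableSet_Icc]
  refine (withDensity_absolutelyContinuous _ _).ae_le ?_
  filter_upwards [h] with x hx
  exact ⟨(Real.exp_pos _).le, Real.exp_le_one_iff.2 (by linarith)⟩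

lemma integral_expImage {ρ : Measure ℝ} (h : ∀ᵐ x ∂ρ, 0 ≤ x) {g : ℝ → ℝ} (hg : Continuous g) :
    ∫ x, g x ∂(expImage ρ) = ∫ x, (1 - Real.exp (-x)) * g (Real.exp (-x)) ∂ρ := by
  rw [expImage, integral_map (by fun_prop) hg.aestronglyMeasurable,
    integral_withDensity_eq_integral_toReal_smul (by fun_prop) (by simp)]
  refine integral_congr_ae ?_
  filter_upwards [h] with x hx
  have : Real.exp (-x) ≤ 1 := Real.exp_le_one_iff.2 (by linarith)
  rw [ENNReal.toReal_ofReal (by linarith), smul_eq_mul]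

lemma integrable_exp_neg_mul {F : Measure ℝ} [IsFiniteMeasure F] (hF : ∀ᵐ x ∂F, 0 ≤ x)
    {θ : ℝ} (hθ : 0 ≤ θ) : Integrable (fun x => Real.exp (-θ * x)) F := by
  refine Integrable.of_bound (by fun_prop) 1 (hF.mono fun x hx => ?_)
  rw [Real.norm_of_nonneg (Real.exp_pos _).le]
  exact Real.exp_le_one_iff.2 (by nlinarith)

lemma lintegral_min_one_lt_top (F : Measure ℝ) [IsFiniteMeasure F] :
    ∫⁻ x, ENNReal.ofReal (min x 1) ∂F < ∞ := by
  calc ∫⁻ x, ENNReal.ofReal (min x 1) ∂F ≤ ∫⁻ _, 1 ∂F :=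
        lintegral_mono fun x => by simp
    _ < ∞ := by simp [measure_lt_top]

/-- Differences of Laplace transforms at consecutive integers are exactly the moments of the
`expImage` measures. -/
lemma tendsto_integral_of_tendsto_laplace {F : ℕ → Measure ℝ} [∀ k, IsFiniteMeasure (F k)]
    (hF : ∀ k, ∀ᵐ x ∂(F k), 0 ≤ x) {c : ℕ → ℝ} (hc : ∀ k, 0 ≤ c k) {ν : Measure ℝ}
    (hν : ∀ᵐ x ∂ν, 0 ≤ x) (hfin : ∫⁻ x, ENNReal.ofReal (min x 1) ∂ν < ∞)
    (hlap : ∀ j : ℕ, Tendsto (fun k => c k * (∫ x, Real.exp (-j * x) ∂(F k) -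
        ∫ x, Real.exp (-(j + 1 : ℕ) * x) ∂(F k))) atTop
      (𝓝 (∫ x, (1 - Real.exp (-x)) * Real.exp (-x) ^ j ∂ν)))
    {g : ℝ → ℝ} (hg : Continuous g) :
    Tendsto (fun k => c k * ∫ x, (1 - Real.exp (-x)) * g (Real.exp (-x)) ∂(F k)) atTop
      (𝓝 (∫ x, (1 - Real.exp (-x)) * g (Real.exp (-x)) ∂ν)) := by
  have := isFiniteMeasure_expImage hfin
  have : ∀ k, IsFiniteMeasure (expImage (F k)) := fun k =>
    isFiniteMeasure_expImage (lintegral_min_one_lt_top _)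
  have key := tendsto_integral_of_tendsto_moments
    (κ := fun k => (c k).toNNReal • expImage (F k)) (κ' := expImage ν)
    (fun k => Measure.ae_smul_measure (ae_mem_Icc_expImage (hF k)) _)
    (ae_mem_Icc_expImage hν) (fun j => ?_) hg
  · simp only [integral_smul_nnreal_measure, integral_expImage hν hg,
      fun k => integral_expImage (hF k) hg] at key
    refine key.congr fun k => ?_
    rw [NNReal.smul_def, Real.coe_toNNReal _ (hc k), smul_eq_mul]
  · simp only [integral_smul_nnreal_measure]
    rw [integral_expImage hν (g := fun x => x ^ j) (by fun_prop)]
    refine (hlap j).congr fun k => ?_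
    rw [NNReal.smul_def, Real.coe_toNNReal _ (hc k), smul_eq_mul,
      integral_expImage (hF k) (g := fun x => x ^ j) (by fun_prop),
      ← integral_sub (integrable_exp_neg_mul (hF k) (by positivity))
        (integrable_exp_neg_mul (hF k) (by positivity))]
    congr 1
    refine integral_congr_ae (Eventually.of_forall fun x => ?_)
    simp only
    rw [sub_mul, one_mul, ← Real.exp_nat_mul, ← Real.exp_add]
    push_cast
    ring_nf

/-- A continuous approximation of the indicator function of `(-∞, b)`, equal to `1` below `a`. -/
noncomputable def ramp (a b w : ℝ) : ℝ := max 0 (min 1 ((b - w) / (b - a)))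

lemma ramp_nonneg (a b w : ℝ) : 0 ≤ ramp a b w := le_max_left _ _

lemma ramp_le_one (a b w : ℝ) : ramp a b w ≤ 1 := max_le zero_le_one (min_le_left _ _)

lemma ramp_eq_one {a b w : ℝ} (hab : a < b) (h : w ≤ a) : ramp a b w = 1 := by
  unfold ramp
  rw [min_eq_left ((one_le_div (sub_pos.2 hab)).2 (by linarith)), max_eq_right zero_le_one]

lemma ramp_eq_zero {a b w : ℝ} (hab : a < b) (h : b ≤ w) : ramp a b w = 0 := by
  unfold ramp
  rw [max_eq_left]
  exact (min_le_right _ _).trans (div_nonpos_of_nonpos_of_nonneg (by linarith) (by linarith))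

/-- The ramp vanishes from b < 1 onwards, so it can be divided by 1 - w; truncating the denominator
at 1 - b keeps the quotient continuous at w = 1. -/
lemma exists_ramp_factor {a b : ℝ} (hab : a < b) (hb : b < 1) :
    ∃ g : ℝ → ℝ, Continuous g ∧ ∀ w, (1 - w) * g w = ramp a b w := by
  refine ⟨fun w => ramp a b w / max (1 - w) (1 - b), ?_, fun w => ?_⟩
  · refine Continuous.div (by unfold ramp; fun_prop) (by fun_prop) fun w => ?_
    exact (lt_max_of_lt_right (sub_pos.2 hb)).ne'
  · rcases le_total b w with h | h
    · simp [ramp_eq_zero hab h]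
    · simp only
      rw [max_eq_left (by linarith)]
      have : 1 - w ≠ 0 := by linarith
      field_simp

lemma measureReal_Ioi_le_integral_ramp {ρ : Measure ℝ} {y z : ℝ} (hyz : y < z)
    (h : ρ (Set.Ioi y) ≠ ∞) :
    ρ.real (Set.Ioi z) ≤ ∫ x, ramp (Real.exp (-z)) (Real.exp (-y)) (Real.exp (-x)) ∂ρ ∧
      ∫ x, ramp (Real.exp (-z)) (Real.exp (-y)) (Real.exp (-x)) ∂ρ ≤ ρ.real (Set.Ioi y) := by
  have hlt : Real.exp (-z) < Real.exp (-y) := Real.exp_lt_exp.2 (by linarith)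
  have hz : ρ (Set.Ioi z) ≠ ∞ :=
    ((measure_mono (Set.Ioi_subset_Ioi hyz.le)).trans_lt h.lt_top).ne
  have iy : Integrable (Set.indicator (Set.Ioi y) (1 : ℝ → ℝ)) ρ :=
    (integrable_indicator_iff measurableSet_Ioi).2 (integrableOn_const h)
  have iz : Integrable (Set.indicator (Set.Ioi z) (1 : ℝ → ℝ)) ρ :=
    (integrable_indicator_iff measurableSet_Ioi).2 (integrableOn_const hz)
  have hle : ∀ x, ramp (Real.exp (-z)) (Real.exp (-y)) (Real.exp (-x)) ≤
      Set.indicator (Set.Ioi y) (1 : ℝ → ℝ) x := fun x => by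
    by_cases hx : y < x
    · rw [Set.indicator_of_mem (by exact hx)]
      exact ramp_le_one _ _ _
    · rw [Set.indicator_of_notMem (by exact hx)]
      exact (ramp_eq_zero hlt (Real.exp_le_exp.2 (by linarith))).le
  have hge : ∀ x, Set.indicator (Set.Ioi z) (1 : ℝ → ℝ) x ≤
      ramp (Real.exp (-z)) (Real.exp (-y)) (Real.exp (-x)) := fun x => by
    by_cases hx : z < x
    · rw [Set.indicator_of_mem (by exact hx)]
      exact (ramp_eq_one hlt (Real.exp_le_exp.2 (by linarith))).ge
    · rw [Set.indicator_of_notMem (by exact hx)]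
      exact ramp_nonneg _ _ _
  have ir : Integrable (fun x => ramp (Real.exp (-z)) (Real.exp (-y)) (Real.exp (-x))) ρ := by
    refine iy.mono' (by unfold ramp; fun_prop) (Eventually.of_forall fun x => ?_)
    rw [Real.norm_of_nonneg (ramp_nonneg _ _ _)]
    exact hle x
  rw [← integral_indicator_one measurableSet_Ioi, ← integral_indicator_one measurableSet_Ioi]
  exact ⟨integral_mono iz ir hge, integral_mono ir iy hle⟩

/-- Ramps squeeze the indicator of a half-line between nearby thresholds, and continuity of the
limiting tail closes the gap. -/
lemma tendsto_measureReal_Ioi_of_tendsto_laplace {F : ℕ → Measure ℝ}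
    [∀ k, IsFiniteMeasure (F k)]
    (hF : ∀ k, ∀ᵐ x ∂(F k), 0 ≤ x) {c : ℕ → ℝ} (hc : ∀ k, 0 ≤ c k) {ν : Measure ℝ}
    (hν : ∀ᵐ x ∂ν, 0 ≤ x) (hfin : ∫⁻ x, ENNReal.ofReal (min x 1) ∂ν < ∞)
    (hlap : ∀ j : ℕ, Tendsto (fun k => c k * (∫ x, Real.exp (-j * x) ∂(F k) -
        ∫ x, Real.exp (-(j + 1 : ℕ) * x) ∂(F k))) atTop
      (𝓝 (∫ x, (1 - Real.exp (-x)) * Real.exp (-x) ^ j ∂ν)))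
    (hνfin : ∀ x > 0, ν (Set.Ioi x) ≠ ∞)
    (hcont : ContinuousOn (fun x => ν.real (Set.Ioi x)) (Set.Ioi 0)) {x : ℝ} (hx : 0 < x) :
    Tendsto (fun k => c k * (F k).real (Set.Ioi x)) atTop (𝓝 (ν.real (Set.Ioi x))) := by
  have hramp : ∀ y z : ℝ, 0 < y → y < z →
      Tendsto (fun k => c k * ∫ x, ramp (Real.exp (-z)) (Real.exp (-y)) (Real.exp (-x)) ∂(F k))
        atTop (𝓝 (∫ x, ramp (Real.exp (-z)) (Real.exp (-y)) (Real.exp (-x)) ∂ν)) := by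
    intro y z hy hyz
    obtain ⟨g, hg, hgr⟩ := exists_ramp_factor (a := Real.exp (-z)) (b := Real.exp (-y))
      (Real.exp_lt_exp.2 (by linarith)) (by rw [Real.exp_lt_one_iff]; linarith)
    simpa only [hgr] using tendsto_integral_of_tendsto_laplace hF hc hν hfin hlap hg
  have hcx := hcont.continuousAt (Ioi_mem_nhds hx)
  refine tendsto_order.2 ⟨fun b hb => ?_, fun b hb => ?_⟩
  · have h1 : ∀ᶠ z in 𝓝[>] x, b < ν.real (Set.Ioi z) :=
      nhdsWithin_le_nhds (hcx.eventually (lt_mem_nhds hb))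
    obtain ⟨z, hz, hxz⟩ := (h1.and self_mem_nhdsWithin).exists
    have h2 := (measureReal_Ioi_le_integral_ramp hxz (hνfin x hx)).1
    filter_upwards [(hramp x z hx hxz).eventually (lt_mem_nhds (hz.trans_le h2))] with k hk
    exact hk.trans_le (mul_le_mul_of_nonneg_left
      (measureReal_Ioi_le_integral_ramp hxz (measure_ne_top _ _)).2 (hc k))
  · have h1 : ∀ᶠ y in 𝓝[<] x, ν.real (Set.Ioi y) < b ∧ 0 < y :=
      nhdsWithin_le_nhds ((hcx.eventually (gt_mem_nhds hb)).and (lt_mem_nhds hx))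
    obtain ⟨y, ⟨hy, hy0⟩, hyx⟩ := (h1.and self_mem_nhdsWithin).exists
    have h2 := (measureReal_Ioi_le_integral_ramp hyx (hνfin y hy0)).2
    filter_upwards [(hramp y x hy0 hyx).eventually (gt_mem_nhds (h2.trans_lt hy))] with k hk
    exact (mul_le_mul_of_nonneg_left
      (measureReal_Ioi_le_integral_ramp hyx (measure_ne_top _ _)).1 (hc k)).trans_lt hk

/-! ### Atoms and the probability integral transform -/

/-- By `hconv` the mass of a heaviest atom x₀ is an average of masses F {r x₀ - x}, none of them
larger. Hence for almost every x the point r x₀ - x is again a heaviest atom, and there are only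
finitely many of these, so x is bounded above. -/
lemma forall_singleton_eq_zero_or_bounded {F : Measure ℝ} [IsProbabilityMeasure F] {r : ℝ}
    (hconv : ∀ z, F {z} = ∫⁻ x, F {r * z - x} ∂F) :
    (∀ x, F {x} = 0) ∨ ∃ B, F (Set.Ioi B) = 0 := by
  by_cases h : ∀ x, F {x} = 0
  · exact Or.inl h
  right
  push Not at h
  obtain ⟨x₁, hx₁⟩ := h
  have hfin : {x | F {x₁} ≤ F {x}}.Finite :=
    Measure.finite_const_le_meas_of_disjoint_iUnion F (pos_iff_ne_zero.2 hx₁)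
      (As := fun x : ℝ => {x}) (fun x => measurableSet_singleton x)
      (fun x y hxy => by simpa using hxy) (measure_ne_top _ _)
  obtain ⟨x₀, hx₀, hmax⟩ := Set.exists_max_image _ (fun x => F {x}) hfin ⟨x₁, le_refl (F {x₁})⟩
  have hmax' : ∀ x, F {x} ≤ F {x₀} := fun x => by
    by_cases hx : F {x₁} ≤ F {x}
    · exact hmax x hx
    · exact (not_le.1 hx).le.trans hx₀
  have hmeas : Measurable fun x => F {r * x₀ - x} := by
    have : MeasurableSet {p : ℝ × ℝ | p.2 = r * x₀ - p.1} :=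
      measurableSet_eq_fun (by fun_prop) (by fun_prop)
    exact measurable_measure_prodMk_left this
  have hae : ∀ᵐ x ∂F, F {r * x₀ - x} = F {x₀} := by
    have h0 : ∫⁻ x, (F {x₀} - F {r * x₀ - x}) ∂F = 0 := by
      rw [lintegral_sub hmeas (hconv x₀ ▸ measure_ne_top _ _)
        (Eventually.of_forall fun x => hmax' _), ← hconv x₀]
      simp
    rw [lintegral_eq_zero_iff (hmeas.const_sub _)] at h0
    filter_upwards [h0] with x hx
    exact le_antisymm (hmax' _) (tsub_eq_zero_iff_le.1 hx)
  obtain ⟨b, hb⟩ := hfin.bddBelow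
  refine ⟨r * x₀ - b, ?_⟩
  rw [measure_eq_zero_iff_ae_notMem]
  filter_upwards [hae] with x hx hmem
  have h1 : b ≤ r * x₀ - x := hb (show F {x₁} ≤ F {r * x₀ - x} by rw [hx]; exact hx₀)
  have : r * x₀ - b < x := hmem
  linarith

lemma continuous_cdf {F : Measure ℝ} [IsProbabilityMeasure F] (h : ∀ x, F {x} = 0) :
    Continuous (cdf F) := by
  rw [continuous_iff_continuousAt]
  intro x
  rw [(monotone_cdf F).continuousAt_iff_leftLim_eq_rightLim, (cdf F).rightLim_eq]
  have h1 := h x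
  rw [← measure_cdf F, StieltjesFunction.measure_singleton, ENNReal.ofReal_eq_zero] at h1
  exact le_antisymm ((monotone_cdf F).leftLim_le le_rfl) (by linarith)

lemma measureReal_Ioi_eq_one_sub_cdf (F : Measure ℝ) [IsProbabilityMeasure F] (x : ℝ) :
    F.real (Set.Ioi x) = 1 - cdf F x := by
  rw [cdf_eq_real, ← Set.compl_Iic, measureReal_compl measurableSet_Iic, probReal_univ]

lemma antitone_measureReal_Ioi (F : Measure ℝ) [IsFiniteMeasure F] :
    Antitone fun x => F.real (Set.Ioi x) := fun _ _ h =>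
  measureReal_mono (Set.Ioi_subset_Ioi h)

lemma exists_measureReal_Ioi_eq {F : Measure ℝ} [IsProbabilityMeasure F] (h : ∀ x, F {x} = 0)
    {u : ℝ} (h0 : 0 < u) (h1 : u < 1) : ∃ x, F.real (Set.Ioi x) = u := by
  obtain ⟨a, ha⟩ := ((tendsto_cdf_atBot F).eventually (gt_mem_nhds (sub_pos.2 h1))).exists
  obtain ⟨b, hb⟩ := ((tendsto_cdf_atTop F).eventually
    (lt_mem_nhds (sub_lt_self 1 h0))).exists
  obtain ⟨x, hx⟩ := mem_range_of_exists_le_of_exists_ge (continuous_cdf h) ⟨a, ha.le⟩ ⟨b, hb.le⟩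
  exact ⟨x, by rw [measureReal_Ioi_eq_one_sub_cdf, hx]; ring⟩

/-- Without atoms the tail function is continuous and attains every level in (0,1), and a half-line
starting at a point of level u has mass u. -/
theorem map_measureReal_Ioi_eq_uniform {F : Measure ℝ} [IsProbabilityMeasure F]
    (h : ∀ x, F {x} = 0) :
    F.map (fun x => F.real (Set.Ioi x)) = volume.restrict (Set.Ioo (0 : ℝ) 1) := by
  have hG := antitone_measureReal_Ioi F
  have hm : Measurable fun x => F.real (Set.Ioi x) := hG.measurable
  have : IsFiniteMeasure (F.map fun x => F.real (Set.Ioi x)) := inferInstance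
  have hlow : ∀ u, 0 < u → u < 1 → ENNReal.ofReal u ≤ F {x | F.real (Set.Ioi x) ≤ u} := by
    intro u h0 h1
    obtain ⟨x, hx⟩ := exists_measureReal_Ioi_eq h h0 h1
    rw [← hx, ofReal_measureReal]
    exact measure_mono fun y hy => hG (le_of_lt hy)
  -- Levels strictly above u are used because the tail may be constant at level u, and because level
  -- 0 need not be attained.
  have hup : ∀ u, 0 ≤ u → u < 1 → F {x | F.real (Set.Ioi x) ≤ u} ≤ ENNReal.ofReal u := by
    intro u h0 h1
    have hlim : Tendsto (fun k : ℕ => ENNReal.ofReal (u + (1 - u) * ((1 / 2 : ℝ) ^ (k + 1))))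
        atTop (𝓝 (ENNReal.ofReal u)) := by
      refine ENNReal.tendsto_ofReal ?_
      have := ((tendsto_pow_atTop_nhds_zero_of_lt_one (r := (1 / 2 : ℝ)) (by norm_num)
        (by norm_num)).comp (tendsto_add_atTop_nat 1)).const_mul (1 - u) |>.const_add u
      simpa using this
    refine ge_of_tendsto' hlim fun k => ?_
    · have hk0 : 0 < (1 / 2 : ℝ) ^ (k + 1) := by positivity
      have hk1 : (1 / 2 : ℝ) ^ (k + 1) < 1 := pow_lt_one₀ (by norm_num) (by norm_num) (by simp)
      obtain ⟨x, hx⟩ := exists_measureReal_Ioi_eq h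
        (u := u + (1 - u) * ((1 / 2 : ℝ) ^ (k + 1))) (by nlinarith) (by nlinarith)
      rw [← hx, ofReal_measureReal]
      refine measure_mono fun y hy => ?_
      by_contra hyx
      have h3 := hG (not_lt.1 hyx)
      have h4 : F.real (Set.Ioi y) ≤ u := hy
      simp only [hx] at h3
      nlinarith
  refine Measure.ext_of_Iic _ _ fun u => ?_
  rw [Measure.map_apply hm measurableSet_Iic, Measure.restrict_apply measurableSet_Iic]
  change F {x | F.real (Set.Ioi x) ≤ u} = _
  rcases lt_or_ge u 0 with h0 | h0
  · have e1 : {x | F.real (Set.Ioi x) ≤ u} = ∅ := by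
      ext x
      simpa using h0.trans_le measureReal_nonneg
    have e2 : Set.Iic u ∩ Set.Ioo 0 1 = ∅ := by ext x; simp; grind
    rw [e1, e2, measure_empty, measure_empty]
  rcases lt_or_ge u 1 with h1 | h1
  · have e2 : Set.Iic u ∩ Set.Ioo 0 1 = Set.Ioc 0 u := by ext x; simp; grind
    rw [e2, Real.volume_Ioc, sub_zero]
    refine le_antisymm (hup u h0 h1) ?_
    rcases h0.eq_or_lt with rfl | h0
    · simp
    · exact hlow u h0 h1
  · have e1 : {x | F.real (Set.Ioi x) ≤ u} = Set.univ := by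
      ext x
      simpa using measureReal_le_one.trans h1
    have e2 : Set.Iic u ∩ Set.Ioo 0 1 = Set.Ioo 0 1 := by ext x; simp; grind
    rw [e1, e2, measure_univ]
    simp

/-! ### Laplace exponent and laws of a selfsimilar subordinator -/

section LevyMeasure

variable {ν : Measure ℝ} {α : ℝ}

/-- The layer cake formula replaces ν by its tail s^(-α), which leaves a Gamma integral. -/
lemma lintegral_one_sub_exp_of_flightTail (hα1 : α < 1) (h0 : ν (Set.Iic 0) = 0)
    (htail : ∀ x : ℝ, 0 < x → flightTail ν x = ENNReal.ofReal (1 / x ^ α)) {θ : ℝ} (hθ : 0 < θ) :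
    ∫⁻ x, ENNReal.ofReal (1 - Real.exp (-θ * x)) ∂ν =
      ENNReal.ofReal (θ ^ α * Real.Gamma (1 - α)) := by
  have hpos : ∀ᵐ x ∂ν, 0 ≤ x := by
    filter_upwards [measure_eq_zero_iff_ae_notMem.1 h0] with x hx
    exact (not_le.1 hx).le
  have hderiv : ∀ x : ℝ, ∫ s in (0 : ℝ)..x, θ * Real.exp (-θ * s) = 1 - Real.exp (-θ * x) := by
    intro x
    have : ∀ s ∈ Set.uIcc (0 : ℝ) x,
        HasDerivAt (fun s => -Real.exp (-θ * s)) (θ * Real.exp (-θ * s)) s := fun s _ => by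
      have := (((hasDerivAt_id s).const_mul (-θ)).exp).neg
      rw [mul_one, mul_neg, neg_neg, mul_comm] at this
      exact this
    rw [intervalIntegral.integral_eq_sub_of_hasDerivAt this
      (Continuous.intervalIntegrable (by fun_prop) _ _)]
    simp
    ring
  have hlc := lintegral_comp_eq_lintegral_meas_lt_mul (f := fun x : ℝ => x)
    (g := fun s => θ * Real.exp (-θ * s)) ν hpos aemeasurable_id
    (fun s _ => Continuous.intervalIntegrable (by fun_prop) _ _)
    (Eventually.of_forall fun s => by positivity)
  simp only [hderiv] at hlc
  rw [hlc]
  have hint : IntegrableOn (fun s : ℝ => θ * (s ^ (-α) * Real.exp (-(θ * s)))) (Set.Ioi 0) := by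
    have := integrableOn_rpow_mul_exp_neg_mul_rpow (p := 1) (s := -α) (b := θ)
      (by linarith) one_pos hθ
    simp only [Real.rpow_one, neg_mul] at this
    exact this.const_mul θ
  have hG := Real.integral_rpow_mul_exp_neg_mul_Ioi (a := 1 - α) (r := θ) (by linarith) hθ
  rw [show (1 - α - 1 : ℝ) = -α by ring] at hG
  calc ∫⁻ s in Set.Ioi 0, ν {a | s < a} * ENNReal.ofReal (θ * Real.exp (-θ * s))
      = ∫⁻ s in Set.Ioi 0, ENNReal.ofReal (θ * (s ^ (-α) * Real.exp (-(θ * s)))) := by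
        refine setLIntegral_congr_fun measurableSet_Ioi fun s hs => ?_
        have hs0 : 0 < s := hs
        have h1 : ν {a | s < a} = ENNReal.ofReal (1 / s ^ α) := htail s hs
        rw [h1, ← ENNReal.ofReal_mul (by positivity)]
        congr 1
        rw [Real.rpow_neg hs0.le, one_div, neg_mul]
        ring
    _ = ENNReal.ofReal (∫ s in Set.Ioi 0, θ * (s ^ (-α) * Real.exp (-(θ * s)))) := by
        rw [ofReal_integral_eq_lintegral_ofReal hint]
        refine (ae_restrict_iff' measurableSet_Ioi).2 (Eventually.of_forall fun s hs => ?_)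
        have hs0 : 0 < s := hs
        simp only [Pi.zero_apply]
        positivity
    _ = ENNReal.ofReal (θ ^ α * Real.Gamma (1 - α)) := by
        rw [integral_const_mul, hG, ← mul_assoc, one_div, Real.inv_rpow hθ.le,
          ← Real.rpow_neg hθ.le]
        nth_rewrite 1 [← Real.rpow_one θ]
        rw [← Real.rpow_add hθ]
        congr 3
        ring

lemma integrable_one_sub_exp_of_flightTail (hα0 : 0 < α) (hα1 : α < 1) (h0 : ν (Set.Iic 0) = 0)
    (htail : ∀ x : ℝ, 0 < x → flightTail ν x = ENNReal.ofReal (1 / x ^ α)) {θ : ℝ} (hθ : 0 ≤ θ) :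
    Integrable (fun x => 1 - Real.exp (-θ * x)) ν ∧
      ∫ x, (1 - Real.exp (-θ * x)) ∂ν = θ ^ α * Real.Gamma (1 - α) := by
  rcases hθ.eq_or_lt with rfl | hθ
  · simp [Real.zero_rpow hα0.ne']
  have hnn : ∀ᵐ x ∂ν, 0 ≤ 1 - Real.exp (-θ * x) := by
    filter_upwards [measure_eq_zero_iff_ae_notMem.1 h0] with x hx
    have hx0 : 0 < x := not_le.1 hx
    have : Real.exp (-θ * x) ≤ 1 := Real.exp_le_one_iff.2 (by nlinarith)
    linarith
  have hl := lintegral_one_sub_exp_of_flightTail hα1 h0 htail hθ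
  have hG : 0 < Real.Gamma (1 - α) := Real.Gamma_pos_of_pos (by linarith)
  refine ⟨⟨by fun_prop, ?_⟩, ?_⟩
  · rw [hasFiniteIntegral_iff_ofReal hnn, hl]
    exact ENNReal.ofReal_lt_top
  · rw [integral_eq_lintegral_of_nonneg_ae hnn (by fun_prop), hl,
      ENNReal.toReal_ofReal (by positivity)]

end LevyMeasure

section Subordinator

variable {Ω : Type*} [MeasurableSpace Ω] {μ : Measure Ω} {L : ℝ≥0 → Ω → ℝ} {ν : Measure ℝ} {α : ℝ}

lemma map_increment_eq (hL : IsSubordinator L μ) (s h : ℝ≥0) :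
    μ.map (fun ω => L (s + h) ω - L s ω) = μ.map (L h) := by
  rw [(hL.stationary s h).map_eq]
  refine Measure.map_congr ?_
  filter_upwards [hL.zero] with ω hω
  rw [hω, sub_zero]

lemma ae_nonneg_law (hL : IsSubordinator L μ) (s : ℝ≥0) : ∀ᵐ x ∂(μ.map (L s)), 0 ≤ x := by
  rw [ae_map_iff (hL.measurable s).aemeasurable measurableSet_Ici]
  filter_upwards [hL.zero, hL.nonneg_increments 0 s zero_le] with ω h0 h1
  linarith

lemma integral_exp_law (hα0 : 0 < α) (hα1 : α < 1) (hL : IsSubordinator L μ)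
    (hν : HasLevyMeasure L μ ν)
    (htail : ∀ x : ℝ, 0 < x → flightTail ν x = ENNReal.ofReal (1 / x ^ α)) (s : ℝ≥0)
    {θ : ℝ} (hθ : 0 ≤ θ) :
    ∫ x, Real.exp (-θ * x) ∂(μ.map (L s)) =
      Real.exp (-(θ ^ α * Real.Gamma (1 - α)) * s) := by
  rw [integral_map (hL.measurable s).aemeasurable (by fun_prop), hν.laplace θ hθ,
    (integrable_one_sub_exp_of_flightTail hα0 hα1 hν.support htail hθ).2]

lemma ae_monotone_rightContinuous (hL : IsSubordinator L μ) :
    ∀ᵐ ω ∂μ, Monotone (fun t => L t ω) ∧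
      ∀ s, ContinuousWithinAt (fun t => L t ω) (Set.Ici s) s := by
  have hmono : ∀ᵐ ω ∂μ, ∀ p q : ℚ≥0, p ≤ q → L p ω ≤ L q ω := by
    rw [ae_all_iff]; intro p; rw [ae_all_iff]; intro q
    by_cases hpq : p ≤ q
    · filter_upwards [hL.nonneg_increments p q (by exact_mod_cast hpq)] with ω hω _
      linarith
    · exact Eventually.of_forall fun ω h => absurd h hpq
  filter_upwards [hmono, hL.cadlag] with ω h1 h2
  exact ⟨monotone_of_forall_rat (fun s => (h2 s).1) h1, fun s => (h2 s).1⟩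

lemma measurable_gridIncrement (hL : IsSubordinator L μ) (t : ℝ≥0) (K i : ℕ) :
    Measurable fun ω => gridIncrement (fun s => L s ω) t K i :=
  (hL.measurable _).sub (hL.measurable _)

lemma iIndepFun_gridIncrement (hL : IsSubordinator L μ) (t : ℝ≥0) (K : ℕ) :
    iIndepFun (fun (i : Fin K) ω => gridIncrement (fun s => L s ω) t K i) μ := by
  have := hL.indep K (fun i => gridPoint t K i) fun i j h => gridPoint_mono t K h
  simpa [gridIncrement] using this

lemma map_gridIncrement (hL : IsSubordinator L μ) (t : ℝ≥0) (K i : ℕ) :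
    μ.map (fun ω => gridIncrement (fun s => L s ω) t K i) = μ.map (L (t / K)) := by
  rw [← map_increment_eq hL (gridPoint t K i) (t / K), ← gridPoint_succ]
  rfl

variable [IsProbabilityMeasure μ]

lemma isProbabilityMeasure_law (hL : IsSubordinator L μ) (s : ℝ≥0) :
    IsProbabilityMeasure (μ.map (L s)) :=
  Measure.isProbabilityMeasure_map (hL.measurable s).aemeasurable

lemma tendsto_mul_one_sub_exp {t : ℝ} (ht : 0 < t) (a : ℝ) :
    Tendsto (fun k : ℕ => (k : ℝ) / t * (1 - Real.exp (-a * (t / k)))) atTop (𝓝 a) := by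
  have hd : HasDerivAt (fun h => Real.exp (-a * h)) (-a) 0 := by
    have := ((hasDerivAt_id (0 : ℝ)).const_mul (-a)).exp
    simpa using this
  have h1 : Tendsto (fun k : ℕ => t / (k : ℝ)) atTop (𝓝[≠] 0) := by
    refine tendsto_nhdsWithin_iff.2 ⟨tendsto_const_div_atTop_nhds_zero_nat t, ?_⟩
    filter_upwards [eventually_gt_atTop 0] with k hk
    have : (0 : ℝ) < k := by exact_mod_cast hk
    exact (div_pos ht this).ne'
  have h2 := ((hasDerivAt_iff_tendsto_slope_zero.1 hd).comp h1).neg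
  rw [neg_neg] at h2
  refine h2.congr' ?_
  filter_upwards [eventually_gt_atTop 0] with k hk
  simp only [Function.comp_apply, zero_add, mul_zero, Real.exp_zero, smul_eq_mul, inv_div]
  ring

/-- The Laplace exponent is the limit of k/t times one minus the Laplace transform of L(t/k), so the
Laplace criterion applies to these laws with weights k/t. -/
lemma tendsto_law_Ioi (hα0 : 0 < α) (hα1 : α < 1) (hL : IsSubordinator L μ)
    (hν : HasLevyMeasure L μ ν)
    (htail : ∀ x : ℝ, 0 < x → flightTail ν x = ENNReal.ofReal (1 / x ^ α))
    {t : ℝ≥0} (ht : 0 < t) {x : ℝ} (hx : 0 < x) :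
    Tendsto (fun k : ℕ => (k : ℝ) / t * (μ.map (L (t / k))).real (Set.Ioi x)) atTop
      (𝓝 (x ^ (-α))) := by
  have hprob := isProbabilityMeasure_law hL
  have htail' : ∀ x > 0, ν.real (Set.Ioi x) = x ^ (-α) := fun x hx => by
    have := htail x hx
    rw [flightTail] at this
    have hx0 : 0 < x := hx
    rw [measureReal_def, this, ENNReal.toReal_ofReal (by positivity), Real.rpow_neg hx0.le, one_div]
  rw [← htail' x hx]
  refine tendsto_measureReal_Ioi_of_tendsto_laplace (F := fun k : ℕ => μ.map (L (t / k)))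
    (c := fun k : ℕ => (k : ℝ) / t) (fun k => ae_nonneg_law hL _) (fun k => by positivity)
    ?_ hν.integrable_min (fun j => ?_) (fun y hy => ?_) ?_ hx
  · filter_upwards [measure_eq_zero_iff_ae_notMem.1 hν.support] with x hx
    exact (not_le.1 hx).le
  · have hj := integrable_one_sub_exp_of_flightTail hα0 hα1 hν.support htail
      (θ := (j : ℝ)) (by positivity)
    have hj1 := integrable_one_sub_exp_of_flightTail hα0 hα1 hν.support htail
      (θ := ((j + 1 : ℕ) : ℝ)) (by positivity)
    have hlim : ∫ x, (1 - Real.exp (-x)) * Real.exp (-x) ^ j ∂ν =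
        ((j + 1 : ℕ) : ℝ) ^ α * Real.Gamma (1 - α) - (j : ℝ) ^ α * Real.Gamma (1 - α) := by
      rw [← hj.2, ← hj1.2, ← integral_sub hj1.1 hj.1]
      congr 1 with x
      rw [sub_mul, one_mul, ← Real.exp_nat_mul, ← Real.exp_add]
      push_cast
      ring_nf
    rw [hlim]
    refine ((tendsto_mul_one_sub_exp (t := t) (by exact_mod_cast ht) _).sub
      (tendsto_mul_one_sub_exp (t := t) (by exact_mod_cast ht) _)).congr fun k => ?_
    rw [integral_exp_law hα0 hα1 hL hν htail _ (by positivity),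
      integral_exp_law hα0 hα1 hL hν htail _ (by positivity)]
    push_cast
    ring
  · have := htail y hy
    rw [flightTail] at this
    rw [this]
    exact ENNReal.ofReal_ne_top
  · have : ContinuousOn (fun x : ℝ => x ^ (-α)) (Set.Ioi 0) := fun y hy =>
      (Real.continuousAt_rpow_const y _ (Or.inl (ne_of_gt hy))).continuousWithinAt
    exact this.congr fun y hy => htail' y hy

/-- L(2s) is distributed like 2^(1/α) L(s) and is also a sum of two independent copies of L(s),
which gives the hypothesis of the maximal atom dichotomy. Boundedness is impossible: a bound on L(s)
would bound every L(s/k), against the positive limit of the rescaled tails. -/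
lemma law_singleton_eq_zero (hα0 : 0 < α) (hα1 : α < 1) (hL : IsSubordinator L μ)
    (hν : HasLevyMeasure L μ ν)
    (htail : ∀ x : ℝ, 0 < x → flightTail ν x = ENNReal.ofReal (1 / x ^ α))
    {s : ℝ≥0} (hs : 0 < s) (x : ℝ) : μ.map (L s) {x} = 0 := by
  have hprob := isProbabilityMeasure_law hL
  -- Chosen so that r^α = 2, matching the doubling of time.
  set r : ℝ := 2 ^ (1 / α) with hr
  have hr0 : 0 < r := by positivity
  have hscale : μ.map (L (s + s)) = (μ.map (L s)).map (fun y => r * y) := by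
    have hm : Measurable fun y : ℝ => r * y := by fun_prop
    refine eq_of_forall_laplace_nat_eq (ae_nonneg_law hL _) ?_ fun j => ?_
    · rw [ae_map_iff hm.aemeasurable measurableSet_Ici]
      filter_upwards [ae_nonneg_law hL s] with y hy
      positivity
    · rw [integral_map hm.aemeasurable (by fun_prop),
        integral_exp_law hα0 hα1 hL hν htail _ (by positivity)]
      have : ∀ y : ℝ, -(j : ℝ) * (r * y) = -(j * r) * y := fun y => by ring
      simp_rw [this]
      rw [integral_exp_law hα0 hα1 hL hν htail _ (by positivity),
        Real.mul_rpow (by positivity) hr0.le, hr, ← Real.rpow_mul (by norm_num),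
        one_div_mul_cancel hα0.ne', Real.rpow_one]
      push_cast
      ring_nf
  have hconv : ∀ z, μ.map (L s) {z} = ∫⁻ y, μ.map (L s) {r * z - y} ∂(μ.map (L s)) := by
    intro z
    have hind := hL.indep.indepFun_eval_sub (zero_le (a := s)) (le_self_add : s ≤ s + s) hL.zero
    have hm1 := hL.measurable s
    have hm2 : Measurable (L (s + s) - L s) := (hL.measurable _).sub hm1
    rw [indepFun_iff_map_prod_eq_prod_map_map hm1.aemeasurable hm2.aemeasurable] at hind
    have hlaw : μ.map (L (s + s) - L s) = μ.map (L s) := map_increment_eq hL s s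
    have hset : MeasurableSet {p : ℝ × ℝ | p.1 + p.2 = r * z} :=
      measurableSet_eq_fun (by fun_prop) (by fun_prop)
    have h1 : μ.map (L (s + s)) {r * z} = μ.map (L s) {z} := by
      rw [hscale, Measure.map_apply (by fun_prop) (measurableSet_singleton _)]
      congr 1
      ext y
      simp [hr0.ne']
    rw [← h1, Measure.map_apply (hL.measurable _) (measurableSet_singleton _)]
    have h2 : L (s + s) ⁻¹' {r * z} = (fun ω => (L s ω, (L (s + s) - L s) ω)) ⁻¹'
        {p : ℝ × ℝ | p.1 + p.2 = r * z} := by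
      ext ω
      simp
    rw [h2, ← Measure.map_apply (hm1.prodMk hm2) hset, hind, hlaw, Measure.prod_apply hset]
    refine lintegral_congr fun y => ?_
    congr 1
    ext w
    simp only [Set.mem_preimage, Set.mem_ofPred_eq, Set.mem_singleton_iff]
    constructor <;> intro h <;> linarith
  rcases forall_singleton_eq_zero_or_bounded hconv with h | ⟨B, hB⟩
  · exact h x
  exfalso
  set b := max B 1 with hb
  have hb0 : 0 < b := lt_max_of_lt_right one_pos
  have hzero : ∀ k : ℕ, (k : ℝ) / s * (μ.map (L (s / k))).real (Set.Ioi b) = 0 := by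
    intro k
    rcases Nat.eq_zero_or_pos k with rfl | hk
    · simp
    · have hle : s / k ≤ s := div_le_self zero_le (by exact_mod_cast hk)
      have : μ.map (L (s / k)) (Set.Ioi b) = 0 := by
        refine le_antisymm ?_ zero_le
        rw [← hB, Measure.map_apply (hL.measurable _) measurableSet_Ioi,
          Measure.map_apply (hL.measurable _) measurableSet_Ioi]
        refine measure_mono_ae ?_
        filter_upwards [hL.nonneg_increments _ _ hle] with ω hω hmem
        have h1 : b < L (s / k) ω := hmem
        have h2 : B ≤ b := le_max_left _ _
        change B < L s ω
        linarith
      rw [measureReal_def, this]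
      simp
  have hlim := tendsto_law_Ioi hα0 hα1 hL hν htail hs hb0
  simp_rw [hzero] at hlim
  have := tendsto_nhds_unique hlim tendsto_const_nhds
  exact (Real.rpow_pos_of_pos hb0 _).ne' this

/-- The tail function of the law of the increments, evaluated at the increments of `L` over the
`K` intervals of equal length of `[0,t]`. -/
noncomputable def uniformIncrement (L : ℝ≥0 → Ω → ℝ) (μ : Measure Ω) (t : ℝ≥0) (K : ℕ) (ω : Ω)
    (i : Fin K) : ℝ :=
  (μ.map (L (t / K))).real (Set.Ioi (gridIncrement (fun s => L s ω) t K i))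

lemma measurable_uniformIncrement (hL : IsSubordinator L μ) (t : ℝ≥0) (K : ℕ) :
    Measurable (uniformIncrement L μ t K) := by
  have := isProbabilityMeasure_law hL (t / K)
  exact measurable_pi_lambda _ fun i =>
    (antitone_measureReal_Ioi (μ.map (L (t / K)))).measurable.comp
      (measurable_gridIncrement hL t K i)

lemma map_uniformIncrement (hα0 : 0 < α) (hα1 : α < 1) (hL : IsSubordinator L μ)
    (hν : HasLevyMeasure L μ ν)
    (htail : ∀ x : ℝ, 0 < x → flightTail ν x = ENNReal.ofReal (1 / x ^ α))
    {t : ℝ≥0} (ht : 0 < t) (K : ℕ) :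
    μ.map (uniformIncrement L μ t K) =
      Measure.pi fun _ : Fin K => volume.restrict (Set.Ioo (0 : ℝ) 1) := by
  have := isProbabilityMeasure_law hL (t / K)
  have hG : Measurable fun x => (μ.map (L (t / K))).real (Set.Ioi x) :=
    (antitone_measureReal_Ioi (μ.map (L (t / K)))).measurable
  have hind := (iIndepFun_gridIncrement hL t K).comp
    (fun _ x => (μ.map (L (t / K))).real (Set.Ioi x)) (fun _ => hG)
  rw [iIndepFun_iff_map_fun_eq_pi_map
    fun i : Fin K => (hG.comp (measurable_gridIncrement hL t K i)).aemeasurable] at hind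
  change μ.map (fun ω i => uniformIncrement L μ t K ω i) = _ at hind
  change μ.map (fun ω i => uniformIncrement L μ t K ω i) = _
  rw [hind]
  congr 1 with i : 1
  rw [← Measure.map_map hG (measurable_gridIncrement hL t K i), map_gridIncrement hL]
  have hK : 0 < K := i.pos
  exact map_measureReal_Ioi_eq_uniform fun x =>
    law_singleton_eq_zero hα0 hα1 hL hν htail (by positivity) x

/-! ### Positivity and approximation of the order sequence -/

lemma le_prod_half_of_card_lt {ι : Type*} [Fintype ι] {n : ℕ} (s : Finset ι) (h : s.card < n)
    [DecidablePred (· ∈ s)] :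
    (1 / 2 : ℝ) ^ n ≤ ∏ i, if i ∈ s then (1 / 2 : ℝ) else 1 := by
  rw [Finset.prod_ite, Finset.prod_const_one, mul_one, Finset.prod_const,
    show Finset.univ.filter (· ∈ s) = s by ext; simp]
  exact pow_le_pow_of_le_one (by norm_num) (by norm_num) h.le

/-- Give each increment of size at least x the factor 1/2 and the others 1. With fewer than n such
increments the product is at least 2^(-n), while independence and 1 + y ≤ exp y bound its
expectation; Markov's inequality concludes. -/
lemma measureReal_encard_gridIncrement_lt (hL : IsSubordinator L μ) (t : ℝ≥0) (K n : ℕ) (x : ℝ) :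
    μ.real {ω | {i : Fin K | x ≤ gridIncrement (fun s => L s ω) t K i}.encard < n} ≤
      2 ^ n * Real.exp (-(K * (μ.map (L (t / K))).real (Set.Ioi x)) / 2) := by
  have hprob := isProbabilityMeasure_law hL (t / K)
  set F := μ.map (L (t / K)) with hF
  let h : ℝ → ℝ := fun y => if x ≤ y then 1 / 2 else 1
  have hh : Measurable h := Measurable.ite measurableSet_Ici measurable_const measurable_const
  have hh0 : ∀ y, 0 ≤ h y := fun y => by simp only [h]; split_ifs <;> norm_num
  have hh1 : ∀ y, h y ≤ 1 := fun y => by simp only [h]; split_ifs <;> norm_num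
  have hξ := fun i : Fin K => measurable_gridIncrement hL t K i
  let Y : Fin K → Ω → ℝ := fun i => h ∘ fun ω => gridIncrement (fun s => L s ω) t K i
  have hY : ∀ i, Measurable (Y i) := fun i => hh.comp (hξ i)
  have hYind : iIndepFun Y μ := (iIndepFun_gridIncrement hL t K).comp (fun _ => h) fun _ => hh
  have hint : ∀ i, ∫ ω, Y i ω ∂μ ≤ Real.exp (-F.real (Set.Ioi x) / 2) := by
    intro i
    have h1 : ∫ ω, Y i ω ∂μ = ∫ y, h y ∂F := by
      rw [hF, ← map_gridIncrement hL t K i,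
        integral_map (hξ i).aemeasurable hh.aestronglyMeasurable]
      rfl
    have h2 : ∫ y, h y ∂F ≤ ∫ y, (1 - Set.indicator (Set.Ioi x) (fun _ => (1 / 2 : ℝ)) y) ∂F := by
      refine integral_mono
        (Integrable.of_bound hh.aestronglyMeasurable 1 (Eventually.of_forall fun y => by
          rw [Real.norm_of_nonneg (hh0 y)]; exact hh1 y))
        ((integrable_const _).sub ((integrable_const _).indicator measurableSet_Ioi)) fun y => ?_
      by_cases hy : x < y
      · simp only [h, hy.le, if_true, Set.indicator_of_mem (Set.mem_Ioi.2 hy)]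
        norm_num
      · rw [Set.indicator_of_notMem (by exact hy), sub_zero]
        exact hh1 y
    rw [h1]
    refine h2.trans ?_
    rw [integral_sub (integrable_const _) ((integrable_const _).indicator measurableSet_Ioi),
      integral_indicator_const _ measurableSet_Ioi, integral_const, probReal_univ]
    simp only [smul_eq_mul, mul_one]
    have := Real.add_one_le_exp (-F.real (Set.Ioi x) / 2)
    linarith
  have hprod : ∫ ω, ∏ i, Y i ω ∂μ ≤ Real.exp (-(K * F.real (Set.Ioi x)) / 2) := by
    rw [hYind.integral_fun_prod_eq_prod_integral fun i => (hY i).aestronglyMeasurable]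
    refine (Finset.prod_le_prod (fun i _ => integral_nonneg fun ω => hh0 _)
      fun i _ => hint i).trans ?_
    rw [Finset.prod_const, Finset.card_univ, Fintype.card_fin, ← Real.exp_nat_mul]
    apply le_of_eq
    congr 1
    ring
  have hP0 : ∀ ω, 0 ≤ ∏ i, Y i ω := fun ω => Finset.prod_nonneg fun i _ => hh0 _
  have hPint : Integrable (fun ω => ∏ i, Y i ω) μ := by
    refine Integrable.of_bound
      (Finset.measurable_fun_prod _ fun i _ => hY i).aestronglyMeasurable 1
      (Eventually.of_forall fun ω => ?_)
    rw [Real.norm_of_nonneg (hP0 ω)]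
    exact Finset.prod_le_one (fun i _ => hh0 _) fun i _ => hh1 _
  have hmarkov := mul_meas_ge_le_integral_of_nonneg (Eventually.of_forall hP0) hPint
    ((1 / 2 : ℝ) ^ n)
  have hsub : {ω | {i : Fin K | x ≤ gridIncrement (fun s => L s ω) t K i}.encard < n} ⊆
      {ω | (1 / 2 : ℝ) ^ n ≤ ∏ i, Y i ω} := by
    intro ω hω
    classical
    let s : Finset (Fin K) := Finset.univ.filter fun i =>
      x ≤ gridIncrement (fun s => L s ω) t K i
    have hs : ({i : Fin K | x ≤ gridIncrement (fun s => L s ω) t K i} : Set (Fin K)) = s := by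
      ext i; simp [s]
    have hcard : s.card < n := by
      have h1 : {i : Fin K | x ≤ gridIncrement (fun s => L s ω) t K i}.encard < n := hω
      rw [hs, Set.encard_coe_eq_coe_finsetCard] at h1
      exact_mod_cast h1
    refine (le_prod_half_of_card_lt s hcard).trans (le_of_eq ?_)
    refine Finset.prod_congr rfl fun i _ => ?_
    simp only [Y, h, Function.comp_apply, s, Finset.mem_filter, Finset.mem_univ, true_and]
  have h3 := measureReal_mono (μ := μ) hsub
  have h4 : (2 : ℝ) ^ n * (1 / 2) ^ n = 1 := by rw [← mul_pow]; norm_num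
  calc μ.real {ω | {i : Fin K | x ≤ gridIncrement (fun s => L s ω) t K i}.encard < n}
      ≤ μ.real {ω | (1 / 2 : ℝ) ^ n ≤ ∏ i, Y i ω} := h3
    _ = 2 ^ n * ((1 / 2) ^ n * μ.real {ω | (1 / 2 : ℝ) ^ n ≤ ∏ i, Y i ω}) := by
        rw [← mul_assoc, h4, one_mul]
    _ ≤ 2 ^ n * Real.exp (-(K * F.real (Set.Ioi x)) / 2) := by
        gcongr
        exact hmarkov.trans hprod

lemma measure_orderFlight_nonpos_le (hα0 : 0 < α) (hα1 : α < 1) (hL : IsSubordinator L μ)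
    (hν : HasLevyMeasure L μ ν)
    (htail : ∀ x : ℝ, 0 < x → flightTail ν x = ENNReal.ofReal (1 / x ^ α))
    {t : ℝ≥0} (ht : 0 < t) {n : ℕ} (hn : 1 ≤ n) {x : ℝ} (hx : 0 < x) :
    μ {ω | orderFlight L n t ω ≤ 0} ≤
      ENNReal.ofReal (2 ^ n * Real.exp (-(t * x ^ (-α)) / 2)) := by
  let A : ℕ → Set Ω := fun K =>
    {ω | {i : Fin K | x ≤ gridIncrement (fun s => L s ω) t K i}.encard < n}
  let B : ℕ → Set Ω := fun K => ⋂ k ≥ K, A k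
  have hB : Monotone B := fun K K' h => Set.biInter_mono (fun k hk => le_trans h hk) fun _ _ => le_rfl
  have hlim : Tendsto (fun K : ℕ => ENNReal.ofReal
      (2 ^ n * Real.exp (-(K * (μ.map (L (t / K))).real (Set.Ioi x)) / 2))) atTop
      (𝓝 (ENNReal.ofReal (2 ^ n * Real.exp (-(t * x ^ (-α)) / 2)))) := by
    refine ENNReal.tendsto_ofReal (Tendsto.const_mul _ ?_)
    refine (Real.continuous_exp.tendsto _).comp (Tendsto.div_const (Tendsto.neg ?_) 2)
    refine ((tendsto_law_Ioi hα0 hα1 hL hν htail ht hx).const_mul (t : ℝ)).congr fun K => ?_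
    have : (t : ℝ) ≠ 0 := by exact_mod_cast ht.ne'
    field_simp
  have hBle : ∀ K, μ (B K) ≤ ENNReal.ofReal (2 ^ n * Real.exp (-(t * x ^ (-α)) / 2)) := by
    intro K
    refine ge_of_tendsto hlim ?_
    filter_upwards [eventually_ge_atTop K] with k hk
    calc μ (B K) ≤ μ (A k) := measure_mono (Set.biInter_subset_of_mem hk)
      _ = ENNReal.ofReal (μ.real (A k)) := (ofReal_measureReal).symm
      _ ≤ _ := ENNReal.ofReal_le_ofReal (measureReal_encard_gridIncrement_lt hL t k n x)
  -- If the n-th flight is not positive, fewer than n flights reach x, so on all fine grids fewer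
  -- than n increments do.
  have hsub : ({ω | orderFlight L n t ω ≤ 0} : Set Ω) ≤ᵐ[μ] (⋃ K, B K : Set Ω) := by
    filter_upwards [ae_monotone_rightContinuous hL] with ω hω hmem
    have hle : nthLargestFlight (fun s => L s ω) n t ≤ 0 := hmem
    have hN : ¬ (n : ℕ∞) ≤ {s : ℝ≥0 | s ∈ Set.Icc 0 t ∧ x ≤ flight (fun s => L s ω) s}.encard :=
      fun h => absurd ((le_nthLargestFlight hω.1 hn hx h).trans hle) (not_le.2 hx)
    obtain ⟨K, hK⟩ := eventually_atTop.1
      (eventually_le_encard_gridIncrement_iff hω.1 hω.2 hx t n)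
    refine Set.mem_iUnion.2 ⟨K, Set.mem_iInter₂.2 fun k hk => ?_⟩
    exact not_le.1 fun h => hN ((hK k hk).1 h)
  refine (measure_mono_ae hsub).trans ?_
  rw [hB.measure_iUnion]
  exact iSup_le hBle

lemma ae_orderFlight_pos (hα0 : 0 < α) (hα1 : α < 1) (hL : IsSubordinator L μ)
    (hν : HasLevyMeasure L μ ν)
    (htail : ∀ x : ℝ, 0 < x → flightTail ν x = ENNReal.ofReal (1 / x ^ α))
    {t : ℝ≥0} (ht : 0 < t) {n : ℕ} (hn : 1 ≤ n) : ∀ᵐ ω ∂μ, 0 < orderFlight L n t ω := by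
  have h0 : μ {ω | orderFlight L n t ω ≤ 0} = 0 := by
    have hlim : Tendsto (fun k : ℕ => ENNReal.ofReal (2 ^ n * Real.exp (-((t : ℝ) / 2 * k))))
        atTop (𝓝 0) := by
      have ht' : (0 : ℝ) < t / 2 := by positivity
      have h1 : Tendsto (fun k : ℕ => (t : ℝ) / 2 * k) atTop atTop :=
        tendsto_natCast_atTop_atTop.const_mul_atTop ht'
      have h2 := (Real.tendsto_exp_neg_atTop_nhds_zero.comp h1).const_mul ((2 : ℝ) ^ n)
      simpa using ENNReal.tendsto_ofReal h2
    refine le_antisymm (ge_of_tendsto hlim ?_) zero_le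
    filter_upwards [eventually_gt_atTop 0] with k hk
    have hk' : (0 : ℝ) < k := by exact_mod_cast hk
    refine (measure_orderFlight_nonpos_le hα0 hα1 hL hν htail ht hn
      -- This threshold satisfies x^(-α) = k, so the bound decays exponentially in k.
      (x := (k : ℝ) ^ (-1 / α)) (by positivity)).trans (le_of_eq ?_)
    rw [← Real.rpow_mul hk'.le, show -1 / α * -α = 1 by field_simp, Real.rpow_one]
    congr 3
    ring
  rw [measure_eq_zero_iff_ae_notMem] at h0
  filter_upwards [h0] with ω hω
  exact not_le.1 hω

/-! ### Limits of order statistics along refining grids. -/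

/-- The tail function reverses order, so the entry with n smaller transforms is the (n+1)-st largest
increment. Injectivity excludes collapsing where `G` is constant. -/
lemma le_encard_iff_of_rankOf_antitone {ι : Type*} [Fintype ι] {ξ : ι → ℝ} {G : ℝ → ℝ}
    (hG : Antitone G) (hinj : Function.Injective fun i => G (ξ i)) {n : ℕ} {i : ι}
    (hi : rankOf (fun i => G (ξ i)) i = n) (x : ℝ) :
    ((n + 1 : ℕ) : ℕ∞) ≤ {l : ι | x ≤ ξ l}.encard ↔ x ≤ ξ i := by
  classical
  have hlt : ∀ l, G (ξ l) < G (ξ i) ↔ ξ i < ξ l := by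
    intro l
    constructor
    · intro h
      by_contra h'
      exact absurd (hG (not_lt.1 h')) (not_le.2 h)
    · intro h
      refine lt_of_le_of_ne (hG h.le) fun heq => ?_
      rw [hinj heq] at h
      exact lt_irrefl _ h
  have hcard : (Finset.univ.filter fun l => ξ i < ξ l).card = n := by
    rw [← hi, rankOf]
    congr 1
    ext l
    simp [hlt]
  have hset : ({l : ι | x ≤ ξ l} : Set ι) = (Finset.univ.filter fun l => x ≤ ξ l : Finset ι) := by
    ext l; simp
  rw [hset, Set.encard_coe_eq_coe_finsetCard, Nat.cast_le]
  constructor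
  · intro h
    by_contra hx
    push Not at hx
    have : (Finset.univ.filter fun l => x ≤ ξ l).card ≤
        (Finset.univ.filter fun l => ξ i < ξ l).card :=
      Finset.card_le_card (Finset.monotone_filter_right _ fun l _ hl => hx.trans_le hl)
    omega
  · intro h
    rw [← hcard, ← Finset.card_insert_of_notMem (a := i) (by simp)]
    refine Finset.card_le_card fun l hl => ?_
    rcases Finset.mem_insert.1 hl with rfl | hl
    · simpa using h
    · simpa using h.trans (Finset.mem_filter.1 hl).2.le

/-- Monotonicity replaces uniform convergence: the moving argument is trapped between fixed points
near X, where pointwise convergence applies. -/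
lemma tendsto_antitone_apply {g : ℕ → ℝ → ℝ} {g' : ℝ → ℝ} {v : ℕ → ℝ} {X : ℝ} (hX : 0 < X)
    (hg : ∀ k, Antitone (g k)) (hlim : ∀ x > 0, Tendsto (fun k => g k x) atTop (𝓝 (g' x)))
    (hcont : ContinuousAt g' X) (hv : Tendsto v atTop (𝓝 X)) :
    Tendsto (fun k => g k (v k)) atTop (𝓝 (g' X)) := by
  refine tendsto_order.2 ⟨fun b hb => ?_, fun b hb => ?_⟩
  · have h1 : ∀ᶠ z in 𝓝[>] X, b < g' z :=
      nhdsWithin_le_nhds (hcont.eventually (lt_mem_nhds hb))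
    obtain ⟨z, hz, hXz⟩ := (h1.and self_mem_nhdsWithin).exists
    have hXz' : X < z := hXz
    filter_upwards [(hlim z (hX.trans hXz')).eventually (lt_mem_nhds hz),
      hv.eventually (gt_mem_nhds hXz')] with k h2 h3
    exact h2.trans_le (hg k h3.le)
  · have h1 : ∀ᶠ y in 𝓝[<] X, g' y < b ∧ 0 < y :=
      nhdsWithin_le_nhds ((hcont.eventually (gt_mem_nhds hb)).and (lt_mem_nhds hX))
    obtain ⟨y, ⟨hy, hy0⟩, hyX⟩ := (h1.and self_mem_nhdsWithin).exists
    have hyX' : y < X := hyX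
    filter_upwards [(hlim y hy0).eventually (gt_mem_nhds hy),
      hv.eventually (lt_mem_nhds hyX')] with k h2 h3
    exact (hg k h3.le).trans_lt h2

lemma ae_injective_uniformIncrement (hα0 : 0 < α) (hα1 : α < 1) (hL : IsSubordinator L μ)
    (hν : HasLevyMeasure L μ ν)
    (htail : ∀ x : ℝ, 0 < x → flightTail ν x = ENNReal.ofReal (1 / x ^ α))
    {t : ℝ≥0} (ht : 0 < t) :
    ∀ᵐ ω ∂μ, ∀ K, Function.Injective (uniformIncrement L μ t K ω) := by
  refine ae_all_iff.2 fun K => ?_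
  have h := ae_injective_pi_uniform (Fin K)
  rw [← map_uniformIncrement hα0 hα1 hL hν htail ht K] at h
  exact ae_of_ae_map (measurable_uniformIncrement hL t K).aemeasurable h

/-- Along the order statistics of rank `n` of the grid increments, the rescaled tail of the law of
the increments converges to the tail of the Lévy measure at the `(n+1)`-st largest flight. -/
lemma tendsto_uniformIncrement_rank (hα0 : 0 < α) (hα1 : α < 1) (hL : IsSubordinator L μ)
    (hν : HasLevyMeasure L μ ν)
    (htail : ∀ x : ℝ, 0 < x → flightTail ν x = ENNReal.ofReal (1 / x ^ α))
    {t : ℝ≥0} (ht : 0 < t) {n : ℕ} {ω : Ω} (hmono : Monotone fun s => L s ω)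
    (hc : ∀ s, ContinuousWithinAt (fun s => L s ω) (Set.Ici s) s)
    (hinj : ∀ K, Function.Injective (uniformIncrement L μ t K ω))
    (hpos : 0 < orderFlight L (n + 1) t ω) {K₀ : ℕ} {r : ∀ k : ℕ, Fin (k + K₀)}
    (hr : ∀ k, rankOf (uniformIncrement L μ t (k + K₀) ω) (r k) = n) :
    Tendsto (fun k : ℕ => ((k + K₀ : ℕ) : ℝ) / t * uniformIncrement L μ t (k + K₀) ω (r k)) atTop
      (𝓝 (orderFlight L (n + 1) t ω ^ (-α))) := by
  have hprob := isProbabilityMeasure_law hL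
  -- The rank is only supplied on grids with at least `K₀` cells; the value 0 below that does not
  -- affect the limit.
  let v : ℕ → ℝ := fun K => if h : K₀ ≤ K then
    gridIncrement (fun s => L s ω) t K (r (K - K₀)) else 0
  have hvk : ∀ k, v (k + K₀) = gridIncrement (fun s => L s ω) t (k + K₀) (r k) := fun k => by
    simp only [v, Nat.le_add_left, dif_pos]
    rw [Nat.add_sub_cancel]
  have hv : Tendsto v atTop (𝓝 (orderFlight L (n + 1) t ω)) := by
    refine tendsto_nthLargestFlight hmono hc (Nat.le_add_left 1 n) hpos ?_
    filter_upwards [eventually_ge_atTop K₀] with K hK x _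
    obtain ⟨k, rfl⟩ := Nat.exists_eq_add_of_le' hK
    rw [hvk]
    exact le_encard_iff_of_rankOf_antitone
      (ξ := fun i : Fin (k + K₀) => gridIncrement (fun s => L s ω) t (k + K₀) i)
      (antitone_measureReal_Ioi _) (hinj _) (hr k) x
  have h1 := tendsto_antitone_apply
    (g := fun (K : ℕ) x => (K : ℝ) / t * (μ.map (L (t / K))).real (Set.Ioi x))
    (g' := fun x => x ^ (-α)) hpos
    (fun K x y hxy => mul_le_mul_of_nonneg_left
      (antitone_measureReal_Ioi (μ.map (L (t / K))) hxy) (by positivity))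
    (fun x hx => tendsto_law_Ioi hα0 hα1 hL hν htail ht hx)
    (Real.continuousAt_rpow_const _ _ (Or.inl hpos.ne')) hv
  refine (h1.comp (tendsto_add_atTop_nat K₀)).congr fun k => ?_
  simp only [Function.comp_apply, hvk]
  rfl

/-- The factor K/t cancels in the quotient, whose limit X^(-α)/X'^(-α) is (X'/X)^α; the exponent p/α
turns α into p. Grids with at least n + m + 2 cells contain both ranks. -/
lemma tendsto_rankRatio_uniformIncrement (hα0 : 0 < α) (hα1 : α < 1) (hL : IsSubordinator L μ)
    (hν : HasLevyMeasure L μ ν)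
    (htail : ∀ x : ℝ, 0 < x → flightTail ν x = ENNReal.ofReal (1 / x ^ α))
    {t : ℝ≥0} (ht : 0 < t) {p : ℝ} (n m : ℕ) :
    ∀ᵐ ω ∂μ, Tendsto
      (fun k : ℕ => rankRatio n m (p / α) (uniformIncrement L μ t (k + (n + m + 2)) ω)) atTop
      (𝓝 (ENNReal.ofReal
        ((orderFlight L (n + m + 2) t ω / orderFlight L (n + 1) t ω) ^ p))) := by
  filter_upwards [ae_monotone_rightContinuous hL,
    ae_injective_uniformIncrement hα0 hα1 hL hν htail ht,
    ae_orderFlight_pos hα0 hα1 hL hν htail ht (Nat.le_add_left 1 n),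
    ae_orderFlight_pos hα0 hα1 hL hν htail ht (Nat.le_add_left 1 (n + m + 1))]
    with ω hω hinj hpos hpos'
  have hex : ∀ k, ∃ i, rankOf (uniformIncrement L μ t (k + (n + m + 2)) ω) i = n := fun k =>
    exists_rankOf_eq (hinj _) (by rw [Fintype.card_fin]; omega)
  have hex' : ∀ k, ∃ i, rankOf (uniformIncrement L μ t (k + (n + m + 2)) ω) i = n + m + 1 :=
    fun k => exists_rankOf_eq (hinj _) (by rw [Fintype.card_fin]; omega)
  choose i hi using hex
  choose j hj using hex'
  have h1 := tendsto_uniformIncrement_rank hα0 hα1 hL hν htail ht hω.1 hω.2 hinj hpos hi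
  have h2 := tendsto_uniformIncrement_rank hα0 hα1 hL hν htail ht hω.1 hω.2 hinj hpos' hj
  have h3 := h1.div h2 (Real.rpow_pos_of_pos hpos' _).ne'
  set X := orderFlight L (n + 1) t ω with hX
  set X' := orderFlight L (n + m + 1 + 1) t ω with hX'
  have hlim : X ^ (-α) / X' ^ (-α) = (X' / X) ^ α := by
    rw [Real.rpow_neg hpos.le, Real.rpow_neg hpos'.le, Real.div_rpow hpos'.le hpos.le]
    field_simp
  have h4 := ENNReal.tendsto_ofReal ((Real.continuousAt_rpow_const _ (p / α)
    (Or.inl (div_pos (Real.rpow_pos_of_pos hpos (-α))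
      (Real.rpow_pos_of_pos hpos' (-α))).ne')).tendsto.comp h3)
  rw [hlim, ← Real.rpow_mul (div_pos hpos' hpos).le, mul_div_cancel₀ _ hα0.ne'] at h4
  refine h4.congr fun k => ?_
  rw [rankRatio_eq (hinj _) (hi k) (hj k)]
  simp only [Function.comp_apply, Pi.div_apply]
  have hc : ((k + (n + m + 2) : ℕ) : ℝ) / t ≠ 0 := by
    have : (0 : ℝ) < t := by exact_mod_cast ht
    positivity
  rw [mul_div_mul_left _ _ hc]

/-! ### Dominated convergence and the moment formula. -/

theorem integrable_and_integral_orderFlight_ratio (hα0 : 0 < α) (hα1 : α < 1)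
    (hL : IsSubordinator L μ) (hν : HasLevyMeasure L μ ν)
    (htail : ∀ x : ℝ, 0 < x → flightTail ν x = ENNReal.ofReal (1 / x ^ α))
    {t : ℝ≥0} (ht : 0 < t) {p : ℝ} (hp : 0 < p) (n m : ℕ) :
    Integrable (fun ω => (orderFlight L (n + m + 2) t ω / orderFlight L (n + 1) t ω) ^ p) μ ∧
    ∫ ω, (orderFlight L (n + m + 2) t ω / orderFlight L (n + 1) t ω) ^ p ∂μ =
      ∏ k ∈ Finset.Ico (n + 1) (n + m + 2), (k : ℝ) / ((k : ℝ) + p / α) := by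
  have hq : 0 ≤ p / α := by positivity
  set Z : Ω → ℝ := fun ω => (orderFlight L (n + m + 2) t ω / orderFlight L (n + 1) t ω) ^ p with hZ
  let T : ℕ → Ω → ℝ≥0∞ := fun k ω =>
    rankRatio n m (p / α) (uniformIncrement L μ t (k + (n + m + 2)) ω)
  have hTm : ∀ k, Measurable (T k) := fun k =>
    (measurable_rankRatio n m _).comp (measurable_uniformIncrement hL t _)
  have hlim : ∀ᵐ ω ∂μ, Tendsto (fun k => T k ω) atTop (𝓝 (ENNReal.ofReal (Z ω))) :=
    tendsto_rankRatio_uniformIncrement hα0 hα1 hL hν htail ht n m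
  have hprod0 : 0 ≤ ∏ k ∈ Finset.Ico (n + 1) (n + m + 2), (k : ℝ) / ((k : ℝ) + p / α) :=
    Finset.prod_nonneg fun k _ => by positivity
  have hT : ∀ k, ∫⁻ ω, T k ω ∂μ = ENNReal.ofReal
      (∏ k ∈ Finset.Ico (n + 1) (n + m + 2), (k : ℝ) / ((k : ℝ) + p / α)) := by
    intro k
    rw [← lintegral_rankRatio (ι := Fin (k + (n + m + 2)))
      (by rw [Fintype.card_fin]; omega) hq,
      ← map_uniformIncrement hα0 hα1 hL hν htail ht,
      lintegral_map (measurable_rankRatio n m _) (measurable_uniformIncrement hL t _)]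
  -- The entry of lower rank is in the numerator, so the ratio never exceeds 1.
  have hbound : ∀ k, T k ≤ᵐ[μ] fun _ => 1 := by
    intro k
    filter_upwards [ae_injective_uniformIncrement hα0 hα1 hL hν htail ht] with ω hinj
    obtain ⟨i, hi⟩ := exists_rankOf_eq (hinj (k + (n + m + 2))) (n := n)
      (by rw [Fintype.card_fin]; omega)
    obtain ⟨j, hj⟩ := exists_rankOf_eq (hinj (k + (n + m + 2))) (n := n + m + 1)
      (by rw [Fintype.card_fin]; omega)
    have hij := (rankOf_lt_iff (uniformIncrement L μ t (k + (n + m + 2)) ω) i j).1 (by omega)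
    simp only [T]
    rw [rankRatio_eq (hinj _) hi hj, ENNReal.ofReal_le_one]
    have hi0 : 0 ≤ uniformIncrement L μ t (k + (n + m + 2)) ω i := measureReal_nonneg
    have hj0 : 0 ≤ uniformIncrement L μ t (k + (n + m + 2)) ω j := measureReal_nonneg
    exact Real.rpow_le_one (by positivity) (div_le_one_of_le₀ hij.le hj0) hq
  have hdct := tendsto_lintegral_of_dominated_convergence (fun _ => (1 : ℝ≥0∞)) hTm hbound
    (by simp) hlim
  simp only [hT] at hdct
  have hZl : ∫⁻ ω, ENNReal.ofReal (Z ω) ∂μ = ENNReal.ofReal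
      (∏ k ∈ Finset.Ico (n + 1) (n + m + 2), (k : ℝ) / ((k : ℝ) + p / α)) :=
    (tendsto_nhds_unique hdct tendsto_const_nhds)
  have hZ0 : ∀ᵐ ω ∂μ, 0 ≤ Z ω := by
    filter_upwards [ae_orderFlight_pos hα0 hα1 hL hν htail ht (Nat.le_add_left 1 n),
      ae_orderFlight_pos hα0 hα1 hL hν htail ht (Nat.le_add_left 1 (n + m + 1))] with ω h1 h2
    exact Real.rpow_nonneg (div_nonneg h2.le h1.le) _
  -- Measurability of the flights, defined by a supremum over paths, is inherited from the almost
  -- sure limit.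
  have hZm : AEStronglyMeasurable Z μ := by
    have h1 : AEMeasurable (fun ω => ENNReal.ofReal (Z ω)) μ :=
      aemeasurable_of_tendsto_metrizable_ae atTop (fun k => (hTm k).aemeasurable) hlim
    refine (h1.ennreal_toReal.congr ?_).aestronglyMeasurable
    filter_upwards [hZ0] with ω hω
    exact ENNReal.toReal_ofReal hω
  refine ⟨⟨hZm, ?_⟩, ?_⟩
  · rw [hasFiniteIntegral_iff_ofReal hZ0, hZl]
    exact ENNReal.ofReal_lt_top
  · rw [integral_eq_lintegral_of_nonneg_ae hZ0 hZm, hZl, ENNReal.toReal_ofReal hprod0]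

end Subordinator

theorem mainTheorem5 {Ω : Type*} [MeasurableSpace Ω] (μ : Measure Ω) [IsProbabilityMeasure μ]
    (α : ℝ) (hα0 : 0 < α) (hα1 : α < 1) (L : ℝ≥0 → Ω → ℝ)
    (hL : IsSelfsimilarSubordinator α L μ)
    (t : ℝ≥0) (ht : 0 < t) (p : ℝ) (hp : 0 < p) :
    (∀ n m : ℕ, 1 ≤ n → 1 ≤ m →
      Integrable (fun ω => (orderFlight L (n + m) t ω / orderFlight L n t ω) ^ p) μ ∧
      ∫ ω, (orderFlight L (n + m) t ω / orderFlight L n t ω) ^ p ∂μ =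
        ∏ k ∈ Finset.Ico n (n + m), (k : ℝ) / ((k : ℝ) + p / α)) ∧
    (∀ n : ℕ, 1 ≤ n →
      ∫ ω, (orderFlight L (n + 1) t ω / orderFlight L n t ω) ^ p ∂μ =
        (n : ℝ) / ((n : ℝ) + p / α)) ∧
    (∀ m : ℕ, 1 ≤ m →
      ∫ ω, (orderFlight L (1 + m) t ω / orderFlight L 1 t ω) ^ p ∂μ =
        ∏ k ∈ Finset.Icc 1 m, (k : ℝ) / ((k : ℝ) + p / α)) := by

  obtain ⟨hL, ν, hν, htail⟩ := hL
  have key : ∀ n m : ℕ, 1 ≤ n → 1 ≤ m →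
      Integrable (fun ω => (orderFlight L (n + m) t ω / orderFlight L n t ω) ^ p) μ ∧
      ∫ ω, (orderFlight L (n + m) t ω / orderFlight L n t ω) ^ p ∂μ =
        ∏ k ∈ Finset.Ico n (n + m), (k : ℝ) / ((k : ℝ) + p / α) := by
    intro n m hn hm
    -- Ranks count from 0 and flights from 1, so both indices are shifted by one.
    obtain ⟨n, rfl⟩ := Nat.exists_eq_add_of_le' hn
    obtain ⟨m, rfl⟩ := Nat.exists_eq_add_of_le' hm
    rw [show n + 1 + (m + 1) = n + m + 2 by ring]
    exact integrable_and_integral_orderFlight_ratio hα0 hα1 hL hν htail ht hp n m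
  refine ⟨key, fun n hn => ?_, fun m hm => ?_⟩
  · rw [(key n 1 hn le_rfl).2, Nat.Ico_succ_singleton, Finset.prod_singleton]
  · rw [(key 1 m le_rfl hm).2]
    refine Finset.prod_congr ?_ fun _ _ => rfl
    ext k
    simp only [Finset.mem_Ico, Finset.mem_Icc]
    omega
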